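/- **Setting.** For $x=(a,b)\in\mathbb F_2^{n}\times\mathbb F_2^{n}$ let $W_x=i^{a\cdot b}\,X^{a_1}Z^{b_1}\otimes\cdots\otimes X^{a_n}Z^{b_n}$ be the Weyl operator (with $a\cdot b$ computed in $\mathbb Z$). A stabilizer state is an $n$-qubit pure state fixed by every element of a group of $2^n$ commuting Pauli operators $i^kW_x$. For an $n$-qubit pure state $|\psi\rangle$ put $F_{\mathcal S}(\psi)=\max\{|\langle\phi|\psi\rangle|^2 : |\phi\rangle \text{ a stabilizer state}\}$, $p_\psi(x)=2^{-n}\langle\psi|W_x|\psi\rangle^2$, $q_\psi(x)=\sum_y p_\psi(y)p_\psi(x+y)$ and $\eta=\sum_x q_\psi(x)\,2^np_\psi(x)$. *Bell difference sampling* of $|\psi\rangle$: for each $i$, measure the $i$-th qubits of two copies of $|\psi\rangle$ in the Bell basis $(W_{(a,b)}\otimes I)\frac{|00\rangle+|11\rangle}{\sqrt2}$, $a,b\in\mathbb F_2$, to obtain $x=(a_1,\dots,a_n,b_1,\dots,b_n)$; do the same with two fresh copies to obtain $y$; return $x+y$. *The tolerant tester*, with inputs $\alpha_1,\alpha_2,\delta$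 and copies of $|\psi\rangle$, sets $\gamma=\alpha_1^6-\frac{3\alpha_2+1}{4}$ and $m=8\log(2/\delta)/\gamma^2$ (natural logarithm), and repeats $\lceil m\rceil$ times: obtain $x$ by Bell difference sampling, then measure the observable $W_x^{\otimes 2}$ on two fresh copies of $|\psi\rangle$, with outcome $X_i\in\{\pm1\}$. It lets $\hat\eta$ be the average of the $X_i$ and outputs $1$ if $\hat\eta>\alpha_1^6-\frac{\gamma}{2}$, and $0$ otherwise. Time is the number of elementary steps. These are: Hadamard gates on an ancilla, controlled one-qubit Weyl gates, Bell measurements of a pair of qubits, one-qubit computational-basis measurements, bit additions, single arithmetic operations, comparisons and reads or writes of real registers, and loop iterations, each counted as one step; loading a copy of $|\psi\rangle$ takes $n$ steps. The measurement of $W_x^{\otimes2}$ is implemented with one ancilla qubit, two Hadamard gates, $2n$ controlled one-qubit Weyl gates and one measurement of the ancilla. **Theorem.** There is an absolute constant $C$ such that the following holds for all $n\ge1$, all $\alpha_1,\alpha_2\in[0,1]$ with $\gamma=\alpha_1^6-\frac{3\alpha_2+1}{4}>0$, all $\delta\in(0,1)$, and all $n$-qubit pure states $|\psi\rangle$. 1.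 With probability at least $1-\delta$, the tester's estimate satisfies $|\hat\eta-\eta|<\gamma/2$. 2. If $F_{\mathcal S}(\psi)\ge\alpha_1$, the tester outputs $1$ with probability at least $1-\delta$. If $F_{\mathcal S}(\psi)\le\alpha_2$, it outputs $0$ with probability at least $1-\delta$. 3. In every run, the tester uses exactly $6\lceil 8\log(2/\delta)/\gamma^2\rceil$ copies of $|\psi\rangle$ (that is, $48\log(2/\delta)/\gamma^2$ copies, up to rounding the number of repetitions to an integer) and takes at most $C\,n\log(2/\delta)/\gamma^2$ steps. If $\delta\le\frac12$, it takes at most $C\,n\log(1/\delta)/\gamma^2$ steps. -/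

import Mathlib

namespace StabTest

noncomputable section

/-! ### Weyl operators, stabilizer states, stabilizer fidelity -/

/-- Pure `n`-qubit states are the unit vectors of this Hilbert space; the computational basis is
labelled by `F_2^n`. -/
abbrev NQubit (n : ℕ) : Type := EuclideanSpace ℂ (Fin n → ZMod 2)

/-- The phase space `F_2^{2n}`, whose elements are written `x = (a, b)`. -/
abbrev Phase (n : ℕ) : Type := (Fin n → ZMod 2) × (Fin n → ZMod 2)

/-- The Pauli matrix `X`. -/
def pauliX : Matrix (ZMod 2) (ZMod 2) ℂ := Matrix.of fun s t => if s = t + 1 then 1 else 0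

/-- The Pauli matrix `Z`. -/
def pauliZ : Matrix (ZMod 2) (ZMod 2) ℂ := Matrix.diagonal fun s => if s = 0 then 1 else -1

/-- The one-qubit Weyl operator `i^{ab} X^a Z^b` (exponents read in `{0, 1}`). -/
def weyl1 (a b : ZMod 2) : Matrix (ZMod 2) (ZMod 2) ℂ :=
  Complex.I ^ (a.val * b.val) • (pauliX ^ a.val * pauliZ ^ b.val)

/-- The Weyl operator `W_x = i^{a·b} X^{a_1} Z^{b_1} ⊗ ⋯ ⊗ X^{a_n} Z^{b_n}`, as a matrix in the
computational basis. -/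
def weyl {n : ℕ} (x : Phase n) : Matrix (Fin n → ZMod 2) (Fin n → ZMod 2) ℂ :=
  Matrix.of fun u v => ∏ i, weyl1 (x.1 i) (x.2 i) (u i) (v i)

/-- `φ` is a stabilizer state: a unit vector fixed by every element of some group of `2^n`
pairwise commuting elements of the Pauli group `{±1, ±i} · {W_x}`. -/
def IsStabilizerState {n : ℕ} (φ : NQubit n) : Prop :=
  ‖φ‖ = 1 ∧ ∃ G : Subgroup (Matrix (Fin n → ZMod 2) (Fin n → ZMod 2) ℂ)ˣ,
    (∀ g ∈ G, ∃ (k : ℕ) (x : Phase n),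
      (g : Matrix (Fin n → ZMod 2) (Fin n → ZMod 2) ℂ) = Complex.I ^ k • weyl x) ∧
    (∀ g ∈ G, ∀ h ∈ G, g * h = h * g) ∧
    Nat.card G = 2 ^ n ∧
    ∀ g ∈ G, Matrix.toEuclideanLin (g : Matrix (Fin n → ZMod 2) (Fin n → ZMod 2) ℂ) φ = φ

/-- The stabilizer fidelity `F_S(ψ) = max_φ |⟨φ|ψ⟩|²` over all stabilizer states `φ`. -/
def stabFidelity {n : ℕ} (ψ : NQubit n) : ℝ :=
  sSup {f : ℝ | ∃ φ : NQubit n, IsStabilizerState φ ∧ f = ‖inner ℂ φ ψ‖ ^ 2}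

/-- The characteristic distribution `p_ψ(x) = 2^{-n} ⟨ψ|W_x|ψ⟩²`
(`W_x` is Hermitian, so `⟨ψ|W_x|ψ⟩` is real). -/
def charDist {n : ℕ} (ψ : NQubit n) (x : Phase n) : ℝ :=
  ‖inner ℂ ψ (Matrix.toEuclideanLin (weyl x) ψ)‖ ^ 2 / 2 ^ n

/-- The Weyl distribution `q_ψ(x) = ∑_y p_ψ(y) p_ψ(x + y)`. -/
def weylDist {n : ℕ} (ψ : NQubit n) (x : Phase n) : ℝ :=
  ∑ y, charDist ψ y * charDist ψ (x + y)

/-- The statistic `η = E_{x ∼ q_ψ}[2^n p_ψ(x)]`. -/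
def eta {n : ℕ} (ψ : NQubit n) : ℝ := ∑ x, weylDist ψ x * (2 ^ n * charDist ψ x)

/-! ### The quantum memory: two `n`-qubit registers and one ancilla qubit -/

/-- `none` is the ancilla, `some (c, i)` is the `i`-th qubit of register `c`. -/
abbrev Qubit (n : ℕ) : Type := Option (Fin 2 × Fin n)

/-- (Unnormalised) state vectors of the quantum memory. -/
abbrev QVec (n : ℕ) : Type := (Qubit n → ZMod 2) → ℂ

def normSq {n : ℕ} (v : QVec n) : ℝ := ∑ u, ‖v u‖ ^ 2

/-- `|0⟩ ⊗ |ψ⟩ ⊗ |ψ⟩`: ancilla cleared, a copy of `ψ` in each register. -/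
def twoCopies {n : ℕ} (ψ : NQubit n) : QVec n := fun u =>
  if u none = 0 then ψ (fun i => u (some (0, i))) * ψ (fun i => u (some (1, i))) else 0

/-- Apply the one-qubit operator `A` to qubit `q`. -/
def apply1 {n : ℕ} (A : Matrix (ZMod 2) (ZMod 2) ℂ) (q : Qubit n) (v : QVec n) : QVec n :=
  fun u => ∑ s, A (u q) s * v (Function.update u q s)

/-- Apply the two-qubit operator `A` to the ordered pair of distinct qubits `(q, r)`. -/
def apply2 {n : ℕ} (A : Matrix (ZMod 2 × ZMod 2) (ZMod 2 × ZMod 2) ℂ) (q r : Qubit n)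
    (v : QVec n) : QVec n :=
  fun u => ∑ s, ∑ t, A (u q, u r) (s, t) * v (Function.update (Function.update u q s) r t)

/-- The Hadamard gate. -/
def hadamard : Matrix (ZMod 2) (ZMod 2) ℂ :=
  Matrix.of fun s t => (if s = 1 ∧ t = 1 then -1 else 1) / (Real.sqrt 2 : ℂ)

/-- The one-qubit projector `|t⟩⟨t|`. -/
def projZ (t : ZMod 2) : Matrix (ZMod 2) (ZMod 2) ℂ :=
  Matrix.diagonal fun s => if s = t then 1 else 0

/-- The controlled one-qubit Weyl operator `|0⟩⟨0| ⊗ I + |1⟩⟨1| ⊗ W_{(a,b)}` (first qubit is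
the control). -/
def ctrlWeyl1 (a b : ZMod 2) : Matrix (ZMod 2 × ZMod 2) (ZMod 2 × ZMod 2) ℂ :=
  Matrix.kronecker (projZ 0) 1 + Matrix.kronecker (projZ 1) (weyl1 a b)

/-- `|Φ⁺⟩ = (|00⟩ + |11⟩)/√2`. -/
def phiPlus : ZMod 2 × ZMod 2 → ℂ := fun s => if s.1 = s.2 then 1 / (Real.sqrt 2 : ℂ) else 0

/-- The Bell basis vector `(W_{(a,b)} ⊗ I)|Φ⁺⟩`. -/
def bellVec (a b : ZMod 2) : ZMod 2 × ZMod 2 → ℂ :=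
  Matrix.mulVec (Matrix.kronecker (weyl1 a b) 1) phiPlus

/-- The projector onto the Bell basis vector labelled `(a, b)`. -/
def bellProj (a b : ZMod 2) : Matrix (ZMod 2 × ZMod 2) (ZMod 2 × ZMod 2) ℂ :=
  Matrix.vecMulVec (bellVec a b) (star (bellVec a b))

/-! ### A step-counting machine: real registers, bit arrays of length `n`, quantum memory -/

/-- Names of the real registers. -/
inductive Var where
  | alpha1 | alpha2 | delta | gamma | m | sum | count | outcome | etaHat | out
  deriving DecidableEq

/-- Names of the bit arrays of length `n`. -/
inductive Arr where
  | xa | xb | ya | yb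
  deriving DecidableEq

/-- Arithmetic expressions over the real registers. -/
inductive Expr where
  | var (v : Var)
  | num (k : ℕ)
  | add (e f : Expr)
  | sub (e f : Expr)
  | mul (e f : Expr)
  | div (e f : Expr)
  | pow (e : Expr) (k : ℕ)
  | log (e : Expr)

/-- Value of an expression. -/
def Expr.eval (reg : Var → ℝ) : Expr → ℝ
  | .var v => reg v
  | .num k => k
  | .add e f => e.eval reg + f.eval reg
  | .sub e f => e.eval reg - f.eval reg
  | .mul e f => e.eval reg * f.eval reg
  | .div e f => e.eval reg / f.eval reg
  | .pow e k => e.eval reg ^ k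
  | .log e => Real.log (e.eval reg)

/-- Number of steps taken to evaluate an expression: one for each register or constant read and
for each operation, `k` for a `k`-th power. -/
def Expr.cost : Expr → ℕ
  | .var _ => 1
  | .num _ => 1
  | .add e f => e.cost + f.cost + 1
  | .sub e f => e.cost + f.cost + 1
  | .mul e f => e.cost + f.cost + 1
  | .div e f => e.cost + f.cost + 1
  | .pow e k => e.cost + k
  | .log e => e.cost + 1

/-- Instructions performed at a qubit position `i`; each takes one step. -/
inductive LocalInstr where
  /-- Measure the `i`-th qubits of the two registers in the Bell basis; store the outcome
  `(a, b)` in `A[i]`, `B[i]`. -/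
  | bell (A B : Arr)
  /-- `A[i] := A[i] + B[i]` in `F_2`. -/
  | addBit (A B : Arr)
  /-- Controlled on the ancilla, apply `W_{(A[i], B[i])}` to the `i`-th qubit of register `c`. -/
  | ctrlWeyl (c : Fin 2) (A B : Arr)

/-- Programs. -/
inductive Cmd where
  | skip
  | seq (c d : Cmd)
  /-- `v := e`. -/
  | assign (v : Var) (e : Expr)
  /-- `v := 1` if `e > f`, and `v := 0` otherwise. -/
  | testGT (v : Var) (e f : Expr)
  /-- Discard the quantum memory, clear the ancilla and put a fresh copy of the input state into
  each of the two registers. -/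
  | load
  /-- Hadamard gate on the ancilla. -/
  | hadamardAnc
  /-- Measure the ancilla in the computational basis; `v := 1` on outcome `|0⟩` and `v := -1` on
  outcome `|1⟩`. -/
  | measureAnc (v : Var)
  /-- For `i = 1, …, n`: perform the listed instructions at position `i`. -/
  | sweep (body : List LocalInstr)
  /-- Repeat the body `⌈e⌉` times. -/
  | rep (e : Expr) (body : Cmd)

/-- One branch of the computation, i.e. one history of measurement outcomes. Its probability is
`weight * normSq vec`: `vec` is the unnormalised vector of the quantum memory, and `weight` is the
probability of the outcomes obtained on quantum memories that have been discarded. -/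
structure Branch (n : ℕ) where
  reg : Var → ℝ
  arr : Arr → Fin n → ZMod 2
  vec : QVec n
  weight : ℝ
  /-- Copies of the input state consumed so far. -/
  copies : ℕ
  /-- Steps taken so far. -/
  time : ℕ

namespace Branch

variable {n : ℕ}

def prob (s : Branch n) : ℝ := s.weight * normSq s.vec

def tick (k : ℕ) (s : Branch n) : Branch n := { s with time := s.time + k }

def setReg (v : Var) (r : ℝ) (s : Branch n) : Branch n :=
  { s with reg := Function.update s.reg v r }

def setBit (A : Arr) (i : Fin n) (t : ZMod 2) (s : Branch n) : Branch n :=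
  { s with arr := Function.update s.arr A (Function.update (s.arr A) i t) }

def mapVec (f : QVec n → QVec n) (s : Branch n) : Branch n := { s with vec := f s.vec }

end Branch

/-- Kleisli iteration: run a branching step `k` times. -/
def iterBranch {S : Type} (f : S → List S) : ℕ → S → List S
  | 0, s => [s]
  | k + 1, s => (f s).flatMap (iterBranch f k)

/-- Perform a list of branching steps in order. -/
def chainBranch {S J : Type} (f : J → S → List S) : List J → S → List S
  | [], s => [s]
  | j :: js, s => (f j s).flatMap (chainBranch f js)

/-- Semantics of the local instructions at position `i`. -/
def LocalInstr.run {n : ℕ} (i : Fin n) : LocalInstr → Branch n → List (Branch n)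
  | .bell A B, s =>
      ([(0, 0), (0, 1), (1, 0), (1, 1)] : List (ZMod 2 × ZMod 2)).map fun o =>
        (((s.mapVec (apply2 (bellProj o.1 o.2) (some (0, i)) (some (1, i)))).setBit A i o.1).setBit
          B i o.2).tick 1
  | .addBit A B, s => [(s.setBit A i (s.arr A i + s.arr B i)).tick 1]
  | .ctrlWeyl c A B, s =>
      [(s.mapVec (apply2 (ctrlWeyl1 (s.arr A i) (s.arr B i)) none (some (c, i)))).tick 1]

/-- Semantics of programs with input state `ψ`: the list of all branches of the computation.
Loading a copy of `ψ` takes one step per qubit; every loop iteration takes one step in addition to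
the steps of its body. -/
def Cmd.run {n : ℕ} (ψ : NQubit n) : Cmd → Branch n → List (Branch n)
  | .skip, s => [s]
  | .seq c d, s => (c.run ψ s).flatMap (d.run ψ)
  | .assign v e, s => [(s.setReg v (e.eval s.reg)).tick (e.cost + 1)]
  | .testGT v e f, s =>
      open Classical in
      [(s.setReg v (if e.eval s.reg > f.eval s.reg then 1 else 0)).tick (e.cost + f.cost + 1)]
  | .load, s =>
      [{ s with
          vec := twoCopies ψ
          weight := s.weight * normSq s.vec
          copies := s.copies + 2
          time := s.time + 2 * n }]
  | .hadamardAnc, s => [(s.mapVec (apply1 hadamard none)).tick 1]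
  | .measureAnc v, s =>
      [((s.mapVec (apply1 (projZ 0) none)).setReg v 1).tick 1,
       ((s.mapVec (apply1 (projZ 1) none)).setReg v (-1)).tick 1]
  | .sweep body, s =>
      chainBranch (fun i t => (chainBranch (LocalInstr.run i) body t).map (Branch.tick 1))
        (List.finRange n) s
  | .rep e body, s =>
      (iterBranch (fun t => (body.run ψ t).map (Branch.tick 1)) ⌈e.eval s.reg⌉₊ s).map
        (Branch.tick (e.cost + 1))

/-- Sequential composition of a list of programs. -/
def Cmd.block (cs : List Cmd) : Cmd := cs.foldr Cmd.seq Cmd.skip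

/-! ### The tolerant tester -/

/-- Bell difference sampling (four copies): measure two copies of `ψ` in the Bell basis to get
`x`, two fresh copies to get `y`, and leave `x + y` in the arrays `xa, xb`. -/
def bellDifferenceSampling : Cmd :=
  Cmd.block [
    .load,
    .sweep [.bell .xa .xb],
    .load,
    .sweep [.bell .ya .yb],
    .sweep [.addBit .xa .ya, .addBit .xb .yb]]

/-- The measurement of the observable `W_x ⊗ W_x` on two fresh copies of `ψ`, for the `x` in the
arrays `xa, xb`, with the ancilla as the control qubit; the outcome `±1` is put into `outcome`. -/
def weylMeasurement : Cmd :=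
  Cmd.block [
    .load,
    .hadamardAnc,
    .sweep [.ctrlWeyl 0 .xa .xb, .ctrlWeyl 1 .xa .xb],
    .hadamardAnc,
    .measureAnc .outcome]

/-- The tolerant property tester for stabilizer states. A single program for all `n`; its inputs
`α₁, α₂, δ` are found in the registers `alpha1, alpha2, delta`. -/
def tolerantTester : Cmd :=
  Cmd.block [
    -- `γ := α₁^6 - (3 α₂ + 1) / 4`
    .assign .gamma (.sub (.pow (.var .alpha1) 6)
      (.div (.add (.mul (.num 3) (.var .alpha2)) (.num 1)) (.num 4))),
    -- `m := 8 log(2/δ) / γ^2`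
    .assign .m (.div (.mul (.num 8) (.log (.div (.num 2) (.var .delta)))) (.pow (.var .gamma) 2)),
    .assign .sum (.num 0),
    .assign .count (.num 0),
    .rep (.var .m) (Cmd.block [
      bellDifferenceSampling,
      weylMeasurement,
      .assign .sum (.add (.var .sum) (.var .outcome)),
      .assign .count (.add (.var .count) (.num 1))]),
    .assign .etaHat (.div (.var .sum) (.var .count)),
    -- output 1 if and only if `etaHat > α₁^6 - γ / 2`
    .testGT .out (.var .etaHat)
      (.sub (.pow (.var .alpha1) 6) (.div (.var .gamma) (.num 2)))]

/-- The start of the computation: inputs in their registers, everything else zero. -/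
def initBranch (n : ℕ) (α₁ α₂ δ : ℝ) : Branch n where
  reg := fun v => match v with
    | .alpha1 => α₁
    | .alpha2 => α₂
    | .delta => δ
    | _ => 0
  arr := fun _ _ => 0
  vec := fun u => if u = 0 then 1 else 0
  weight := 1
  copies := 0
  time := 0

/-- All branches of a run of the tester on input state `ψ`. -/
def testerRuns {n : ℕ} (ψ : NQubit n) (α₁ α₂ δ : ℝ) : List (Branch n) :=
  tolerantTester.run ψ (initBranch n α₁ α₂ δ)

open Classical in
/-- The probability that the run of the tester ends in a branch with property `E`. -/
def testerProb {n : ℕ} (ψ : NQubit n) (α₁ α₂ δ : ℝ) (E : Branch n → Prop) : ℝ :=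
  ((testerRuns ψ α₁ α₂ δ).map fun s => if E s then s.prob else 0).sum

end

end StabTest

/-!
The proof has two halves, which meet in the number `η`.

*The program estimates `η`.* Let `e(x) = ⟨ψ|W_x|ψ⟩`, so that `p_ψ(x) = 2^{-n} e(x)²`. The one-qubit
identity `½ ∑_y (-1)^{[x,y]} W_y ⊗ W_y = (W_x ⊗ W_x) SWAP` shows that `2^n p_ψ` is the symplectic
Fourier transform of `p_ψ` (`sum_chi_charDist`). Expanding the Bell projectors in Weyl operators
shows that the outcome distribution of a Bell measurement is the transform of the same function up
to signs (`normSq_bellMeasurement`). The signs disappear in the autocorrelation, hence the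
difference of two Bell samples is distributed as `q_ψ` (`sum_bellDist_mul_bellDist`). The Hadamard
test for `W_x ⊗ W_x` has mean `e(x)² = 2^n p_ψ(x)` (`normSq_testVec`), so one round of the loop
yields a sign of mean `η`, whatever happened before (`branchSum_testerBody`). Therefore the
exponential moments of the sum of the outcomes factorise over the rounds (`sum_rounds_exp`), and
Hoeffding's lemma with the Chernoff bound gives the estimate with probability `1 - δ`
(`one_sub_le_testerProb`).

*`η` controls the stabilizer fidelity.* By Fourier analysis `η = 2^{-n} ∑_x e(x)^6`
(`eta_eq_sum_weylExp`). If `φ` is stabilized by `G`, the projection to the vectors fixed by `G` is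
the average of `2^n` distinct Weyl operators up to phases, and its expectation is at least
`|⟨φ|ψ⟩|²`; the power mean inequality gives `F_S(ψ)^6 ≤ η` (`stabFidelity_pow_six_le_eta`).
Conversely, the Weyl operators with `e(x)² > 1/2` commute by an uncertainty principle, so they lie
in a set `T` that is its own symplectic complement, and `η ≤ 1/4 + 3/4 · p_ψ(T)`. Decomposing `ψ`
into joint eigenvectors of the operators of `T` bounds `p_ψ(T)` by `F_S(ψ)`, since each joint
eigenvector determines a stabilizer group inside `{i^k W_x : x ∈ T}`
(`sum_charDist_le_stabFidelity`). Together `η ≤ (3 F_S(ψ) + 1) / 4` (`eta_le_stabFidelity`).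

The threshold `α₁^6 - γ/2` lies midway between `α₁^6` and `(3 α₂ + 1) / 4`.
-/

namespace StabTest

noncomputable section

open Complex Matrix

/-! ### Tensor products and the algebra of Weyl operators -/

/-- The tensor product `K 0 ⊗ ⋯ ⊗ K (n - 1)`, as a matrix indexed by tuples. -/
def tensor {n : ℕ} {P : Type*} (K : Fin n → Matrix P P ℂ) :
    Matrix (Fin n → P) (Fin n → P) ℂ :=
  Matrix.of fun u v => ∏ i, K i (u i) (v i)

section Tensor

variable {n : ℕ} {P : Type*}

lemma tensor_apply (K : Fin n → Matrix P P ℂ) (u v : Fin n → P) :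
    tensor K u v = ∏ i, K i (u i) (v i) := rfl

lemma tensor_mul [Fintype P] [DecidableEq P] (A B : Fin n → Matrix P P ℂ) :
    tensor A * tensor B = tensor fun i => A i * B i := by
  ext u v
  simp only [Matrix.mul_apply, tensor_apply, ← Finset.prod_mul_distrib]
  rw [Finset.prod_univ_sum, Fintype.piFinset_univ]

lemma tensor_conjTranspose (A : Fin n → Matrix P P ℂ) :
    (tensor A)ᴴ = tensor fun i => (A i)ᴴ := by
  ext u v
  simp [tensor_apply, Matrix.conjTranspose_apply]

lemma tensor_one [Fintype P] [DecidableEq P] :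
    tensor (fun _ : Fin n => (1 : Matrix P P ℂ)) = 1 := by
  ext u v
  simp only [tensor_apply, Matrix.one_apply, Finset.prod_ite_zero, Finset.prod_const_one,
    funext_iff, Finset.mem_univ, forall_const]

lemma tensor_smul (c : Fin n → ℂ) (A : Fin n → Matrix P P ℂ) :
    tensor (fun i => c i • A i) = (∏ i, c i) • tensor A := by
  ext u v
  simp [tensor_apply, Finset.prod_mul_distrib]

end Tensor

/-- The nontrivial character `z ↦ (-1)^z` of `F_2`. -/
def chi (z : ZMod 2) : ℝ := if z = 0 then 1 else -1

@[simp] lemma chi_zero : chi 0 = 1 := by simp [chi]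

@[simp] lemma chi_one : chi 1 = -1 := by simp [chi]

lemma forall_zmod_two {p : ZMod 2 → Prop} : (∀ a, p a) ↔ p 0 ∧ p 1 :=
  Fin.forall_fin_two

lemma sum_zmod_two {M : Type*} [AddCommMonoid M] (f : ZMod 2 → M) : ∑ a, f a = f 0 + f 1 :=
  Fin.sum_univ_two f

lemma zmod_two_one_add_one : (1 + 1 : ZMod 2) = 0 := by decide

lemma zmod_two_val_one : (1 : ZMod 2).val = 1 := rfl

lemma chi_add (a b : ZMod 2) : chi (a + b) = chi a * chi b := by
  revert a b
  simp [forall_zmod_two, zmod_two_one_add_one]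

lemma chi_mul_self (a : ZMod 2) : chi a * chi a = 1 := by
  revert a
  simp [forall_zmod_two]

lemma chi_sum {ι : Type*} (s : Finset ι) (f : ι → ZMod 2) :
    chi (∑ i ∈ s, f i) = ∏ i ∈ s, chi (f i) := by
  classical
  induction s using Finset.induction_on with
  | empty => simp
  | insert a s ha ih => rw [Finset.sum_insert ha, Finset.prod_insert ha, chi_add, ih]

lemma chi_eq_one_iff {a : ZMod 2} : chi a = 1 ↔ a = 0 := by
  revert a
  norm_num [forall_zmod_two]

/-- Entries of the one-qubit Weyl operators: `W_{(a,b)} |t⟩ = i^{ab} (-1)^{bt} |t + a⟩`. -/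
lemma weyl1_apply (a b s t : ZMod 2) :
    weyl1 a b s t = I ^ (a.val * b.val) * ((if s = t + a then 1 else 0) * (chi (b * t) : ℂ)) := by
  revert a b s t
  simp [forall_zmod_two, weyl1, pauliX, pauliZ, zmod_two_val_one, zmod_two_one_add_one,
    Matrix.mul_apply, sum_zmod_two]

lemma weyl1_conjTranspose (a b : ZMod 2) : (weyl1 a b)ᴴ = weyl1 a b := by
  ext s t
  rw [Matrix.conjTranspose_apply, weyl1_apply, weyl1_apply]
  revert a b s t
  simp [forall_zmod_two, zmod_two_val_one, zmod_two_one_add_one]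

lemma weyl1_zero : weyl1 0 0 = 1 := by
  ext s t
  simp [weyl1_apply, Matrix.one_apply]

/-- The exponent comes from `X^a Z^b X^c Z^d = (-1)^{bc} X^{a+c} Z^{b+d}` and the normalising
phases of the three Weyl operators. -/
lemma weyl1_mul (a b c d : ZMod 2) :
    weyl1 a b * weyl1 c d = I ^ (a.val * b.val + c.val * d.val + 2 * (b.val * c.val) +
      3 * ((a + c).val * (b + d).val)) • weyl1 (a + c) (b + d) := by
  ext s t
  simp only [Matrix.smul_apply, Matrix.mul_apply, weyl1_apply, sum_zmod_two, smul_eq_mul]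
  revert a b c d s t
  simp [forall_zmod_two, zmod_two_val_one, zmod_two_one_add_one, pow_succ]

lemma weyl1_mul_comm (a b c d : ZMod 2) :
    weyl1 a b * weyl1 c d = (chi (a * d + b * c) : ℂ) • (weyl1 c d * weyl1 a b) := by
  ext s t
  simp only [Matrix.smul_apply, Matrix.mul_apply, weyl1_apply]
  revert a b c d s t
  simp [forall_zmod_two, zmod_two_val_one, zmod_two_one_add_one]

lemma weyl1_mul_self (a b : ZMod 2) : weyl1 a b * weyl1 a b = 1 := by
  ext s t
  simp only [Matrix.mul_apply, weyl1_apply, Matrix.one_apply]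
  revert a b s t
  simp [forall_zmod_two, zmod_two_val_one, zmod_two_one_add_one]

/-- On one qubit, `½ ∑_y (-1)^{[x,y]} W_y ⊗ W_y = (W_x ⊗ W_x) SWAP`. -/
lemma sum_chi_weyl1 (a b s t s' t' : ZMod 2) :
    ∑ y : ZMod 2 × ZMod 2, (chi (a * y.2 + b * y.1) : ℂ) *
      (weyl1 y.1 y.2 s t * weyl1 y.1 y.2 s' t') = 2 * (weyl1 a b s t' * weyl1 a b s' t) := by
  simp only [Fintype.sum_prod_type, sum_zmod_two, weyl1_apply]
  revert a b s t s' t'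
  simp [forall_zmod_two, zmod_two_val_one, zmod_two_one_add_one]
  norm_num

lemma inv_sqrt_two_mul_self : ((Real.sqrt 2 : ℝ) : ℂ)⁻¹ * ((Real.sqrt 2 : ℝ) : ℂ)⁻¹ = 1 / 2 := by
  rw [← mul_inv, ← Complex.ofReal_mul, Real.mul_self_sqrt (by norm_num)]
  norm_num

lemma I_mul_inv_sqrt_two_mul_self :
    I * ((Real.sqrt 2 : ℝ) : ℂ)⁻¹ * (I * ((Real.sqrt 2 : ℝ) : ℂ)⁻¹) = -(1 / 2) := by
  rw [mul_mul_mul_comm, inv_sqrt_two_mul_self, I_mul_I, neg_one_mul]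

/-- The Bell projectors expanded in Weyl operators. -/
lemma bellProj_apply (a b s t s' t' : ZMod 2) :
    bellProj a b (s, s') (t, t') = (1 / 4) * ∑ y : ZMod 2 × ZMod 2,
      (chi (a * y.2 + b * y.1) : ℂ) * ((chi (y.1 * y.2) : ℂ) *
      (weyl1 y.1 y.2 s t * weyl1 y.1 y.2 s' t')) := by
  simp only [bellProj, bellVec, Matrix.vecMulVec_apply, Matrix.mulVec, dotProduct, phiPlus,
    Matrix.kronecker, Matrix.kroneckerMap_apply, Pi.star_apply,
    Fintype.sum_prod_type, sum_zmod_two, weyl1_apply, Matrix.one_apply]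
  revert a b s t s' t'
  simp [forall_zmod_two, zmod_two_val_one, zmod_two_one_add_one]
  norm_num [inv_sqrt_two_mul_self, I_mul_inv_sqrt_two_mul_self]

lemma bellProj_conjTranspose (a b : ZMod 2) : (bellProj a b)ᴴ = bellProj a b := by
  rw [bellProj, Matrix.conjTranspose_vecMulVec, star_star]

lemma bellProj_mul_self (a b : ZMod 2) : bellProj a b * bellProj a b = bellProj a b := by
  have h : star (bellVec a b) ⬝ᵥ bellVec a b = 1 := by
    simp only [bellVec, Matrix.mulVec, dotProduct, phiPlus,
      Matrix.kronecker, Matrix.kroneckerMap_apply, Pi.star_apply,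
      Fintype.sum_prod_type, sum_zmod_two, weyl1_apply, Matrix.one_apply]
    revert a b
    simp [forall_zmod_two, zmod_two_val_one, zmod_two_one_add_one]
    norm_num [inv_sqrt_two_mul_self, I_mul_inv_sqrt_two_mul_self]
  rw [bellProj, Matrix.vecMulVec_mul_vecMulVec, h, one_smul]

/-- The symplectic form `[x, y]` on the phase space. -/
def symp {n : ℕ} (x y : Phase n) : ZMod 2 := ∑ i, (x.1 i * y.2 i + x.2 i * y.1 i)

variable {n : ℕ}

lemma symp_comm (x y : Phase n) : symp x y = symp y x :=
  Finset.sum_congr rfl fun i _ => by ring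

lemma symp_add_left (x y z : Phase n) : symp (x + y) z = symp x z + symp y z := by
  rw [symp, symp, symp, ← Finset.sum_add_distrib]
  refine Finset.sum_congr rfl fun i _ => ?_
  simp only [Prod.fst_add, Prod.snd_add, Pi.add_apply]
  ring

lemma symp_add_right (x y z : Phase n) : symp x (y + z) = symp x y + symp x z := by
  rw [symp_comm, symp_add_left, symp_comm y, symp_comm z]

lemma symp_self (x : Phase n) : symp x x = 0 :=
  Finset.sum_eq_zero fun i _ => by rw [mul_comm (x.2 i), CharTwo.add_self_eq_zero]

lemma weyl_eq_tensor (x : Phase n) : weyl x = tensor fun i => weyl1 (x.1 i) (x.2 i) := rfl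

lemma weyl_conjTranspose (x : Phase n) : (weyl x)ᴴ = weyl x := by
  simp only [weyl_eq_tensor, tensor_conjTranspose, weyl1_conjTranspose]

lemma weyl_zero : weyl (0 : Phase n) = 1 := by
  simp [weyl_eq_tensor, weyl1_zero, tensor_one]

lemma weyl_mul_self (x : Phase n) : weyl x * weyl x = 1 := by
  simp only [weyl_eq_tensor, tensor_mul, weyl1_mul_self, tensor_one]

lemma weyl_mul (x y : Phase n) : ∃ k : ℕ, weyl x * weyl y = I ^ k • weyl (x + y) := by
  simp only [weyl_eq_tensor, tensor_mul, weyl1_mul, tensor_smul, Finset.prod_pow_eq_pow_sum]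
  exact ⟨_, rfl⟩

lemma weyl_mul_comm (x y : Phase n) :
    weyl x * weyl y = (chi (symp x y) : ℂ) • (weyl y * weyl x) := by
  simp only [weyl_eq_tensor, tensor_mul]
  rw [symp, chi_sum, Complex.ofReal_prod, ← tensor_smul]
  simp only [← weyl1_mul_comm]

/-- Summation over the phase space factorises over the qubits. -/
lemma sum_phase_prod {R : Type*} [CommSemiring R] (f : Fin n → ZMod 2 × ZMod 2 → R) :
    ∑ y : Phase n, ∏ i, f i (y.1 i, y.2 i) = ∏ i, ∑ p, f i p := by
  rw [Finset.prod_univ_sum, Fintype.piFinset_univ]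
  exact ((Equiv.arrowProdEquivProdArrow (Fin n) (fun _ => ZMod 2) (fun _ => ZMod 2)).sum_comp
    fun y : Phase n => ∏ i, f i (y.1 i, y.2 i)).symm

/-! ### Fourier analysis of the characteristic distribution -/

/-- The action of the Weyl operator `W_x` on states. -/
abbrev weylMap (x : Phase n) : NQubit n →ₗ[ℂ] NQubit n := Matrix.toEuclideanLin (weyl x)

lemma weylMap_isSymmetric (x : Phase n) : (weylMap x).IsSymmetric :=
  Matrix.isSymmetric_toEuclideanLin_iff.2 (weyl_conjTranspose x)

lemma toEuclideanLin_mul_apply (A B : Matrix (Fin n → ZMod 2) (Fin n → ZMod 2) ℂ)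
    (φ : NQubit n) : Matrix.toEuclideanLin (A * B) φ =
      Matrix.toEuclideanLin A (Matrix.toEuclideanLin B φ) := by
  rw [Matrix.toEuclideanLin, Matrix.toLpLin_mul_same, LinearMap.comp_apply]

lemma toEuclideanLin_one_apply (φ : NQubit n) :
    Matrix.toEuclideanLin (1 : Matrix (Fin n → ZMod 2) (Fin n → ZMod 2) ℂ) φ = φ := by
  rw [Matrix.toEuclideanLin, Matrix.toLpLin_one, LinearMap.id_apply]

lemma weylMap_weylMap (x : Phase n) (φ : NQubit n) : weylMap x (weylMap x φ) = φ := by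
  rw [← toEuclideanLin_mul_apply, weyl_mul_self, toEuclideanLin_one_apply]

lemma norm_weylMap (x : Phase n) (φ : NQubit n) : ‖weylMap x φ‖ = ‖φ‖ := by
  have h : inner ℂ (weylMap x φ) (weylMap x φ) = inner ℂ φ φ := by
    rw [weylMap_isSymmetric, weylMap_weylMap]
  rw [inner_self_eq_norm_sq_to_K, inner_self_eq_norm_sq_to_K] at h
  exact (sq_eq_sq₀ (norm_nonneg _) (norm_nonneg _)).1 (by exact_mod_cast h)

/-- The expectation `⟨ψ|W_x|ψ⟩`, as a real number. -/
def weylExp (ψ : NQubit n) (x : Phase n) : ℝ := (inner ℂ ψ (weylMap x ψ)).re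

lemma ofReal_weylExp (ψ : NQubit n) (x : Phase n) :
    (weylExp ψ x : ℂ) = inner ℂ ψ (weylMap x ψ) := by
  rw [weylExp, ← Complex.conj_eq_iff_re, inner_conj_symm, weylMap_isSymmetric]

lemma ofReal_weylExp_eq_sum (ψ : NQubit n) (x : Phase n) :
    (weylExp ψ x : ℂ) = ∑ u, ∑ v, star (ψ u) * weyl x u v * ψ v := by
  rw [ofReal_weylExp, PiLp.inner_apply]
  refine Finset.sum_congr rfl fun u _ => ?_
  rw [RCLike.inner_apply, mul_comm, Matrix.toLpLin_apply]
  simp only [Matrix.mulVec, dotProduct, Finset.mul_sum, mul_assoc]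
  rfl

lemma norm_inner_weylMap (ψ : NQubit n) (x : Phase n) :
    ‖inner ℂ ψ (weylMap x ψ)‖ = |weylExp ψ x| := by
  rw [← ofReal_weylExp, Complex.norm_real, Real.norm_eq_abs]

lemma abs_weylExp_le_one {ψ : NQubit n} (hψ : ‖ψ‖ = 1) (x : Phase n) : |weylExp ψ x| ≤ 1 := by
  rw [← norm_inner_weylMap]
  refine (norm_inner_le_norm _ _).trans ?_
  rw [norm_weylMap, hψ, one_mul]

lemma weylExp_zero {ψ : NQubit n} (hψ : ‖ψ‖ = 1) : weylExp ψ 0 = 1 := by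
  have h : (weylExp ψ 0 : ℂ) = 1 := by
    rw [ofReal_weylExp, weylMap, weyl_zero, toEuclideanLin_one_apply,
      inner_self_eq_norm_sq_to_K, hψ]
    simp
  exact_mod_cast h

lemma charDist_eq (ψ : NQubit n) (x : Phase n) : charDist ψ x = weylExp ψ x ^ 2 / 2 ^ n := by
  rw [charDist, norm_inner_weylMap, sq_abs]

lemma charDist_nonneg (ψ : NQubit n) (x : Phase n) : 0 ≤ charDist ψ x := by
  rw [charDist_eq]; positivity

lemma two_pow_mul_charDist (ψ : NQubit n) (x : Phase n) :
    2 ^ n * charDist ψ x = weylExp ψ x ^ 2 := by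
  rw [charDist_eq]; field_simp

lemma two_pow_mul_two_pow (n : ℕ) : (2 : ℝ) ^ n * 2 ^ n = 4 ^ n := by
  rw [← mul_pow]
  norm_num

/-- `2^{-n} ∑_y (-1)^{[x,y]} W_y ⊗ W_y = (W_x ⊗ W_x) SWAP`, entry by entry. -/
lemma sum_chi_weyl (x : Phase n) (u v u' v' : Fin n → ZMod 2) :
    ∑ y : Phase n, (chi (symp x y) : ℂ) * (weyl y u v * weyl y u' v') =
      2 ^ n * (weyl x u v' * weyl x u' v) := by
  simp only [symp, chi_sum, Complex.ofReal_prod, weyl_eq_tensor, tensor_apply,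
    ← Finset.prod_mul_distrib]
  rw [sum_phase_prod fun i p => (chi (x.1 i * p.2 + x.2 i * p.1) : ℂ) *
    (weyl1 p.1 p.2 (u i) (v i) * weyl1 p.1 p.2 (u' i) (v' i))]
  simp only [sum_chi_weyl1, Finset.prod_mul_distrib, Finset.prod_const, Finset.card_univ,
    Fintype.card_fin]

/-- The squared Weyl expectations are, up to scaling, their own symplectic Fourier transform. -/
lemma sum_chi_weylExp_sq (ψ : NQubit n) (x : Phase n) :
    ∑ y, chi (symp x y) * weylExp ψ y ^ 2 = 2 ^ n * weylExp ψ x ^ 2 := by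
  have key : ∀ y : Phase n, (weylExp ψ y : ℂ) ^ 2 = ∑ u, ∑ v, ∑ u', ∑ v',
      (star (ψ u) * ψ v * star (ψ u') * ψ v') * (weyl y u v * weyl y u' v') := fun y => by
    rw [sq, ofReal_weylExp_eq_sum]
    simp only [Finset.sum_mul]
    refine Finset.sum_congr rfl fun u _ => Finset.sum_congr rfl fun v _ => ?_
    simp only [Finset.mul_sum]
    refine Finset.sum_congr rfl fun u' _ => Finset.sum_congr rfl fun v' _ => ?_
    ring
  have : (∑ y, (chi (symp x y) : ℂ) * (weylExp ψ y : ℂ) ^ 2) = 2 ^ n * (weylExp ψ x : ℂ) ^ 2 := by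
    calc _ = ∑ u, ∑ v, ∑ u', ∑ v', (star (ψ u) * ψ v * star (ψ u') * ψ v') *
          ∑ y : Phase n, (chi (symp x y) : ℂ) * (weyl y u v * weyl y u' v') := by
          simp only [key, Finset.mul_sum]
          rw [Finset.sum_comm]
          refine Finset.sum_congr rfl fun u _ => ?_
          rw [Finset.sum_comm]
          refine Finset.sum_congr rfl fun v _ => ?_
          rw [Finset.sum_comm]
          refine Finset.sum_congr rfl fun u' _ => ?_
          rw [Finset.sum_comm]
          refine Finset.sum_congr rfl fun v' _ => Finset.sum_congr rfl fun y _ => ?_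
          ring
      _ = _ := by
          simp only [sum_chi_weyl, key x, Finset.mul_sum]
          refine Finset.sum_congr rfl fun u _ => ?_
          rw [Finset.sum_comm]
          conv_rhs => rw [Finset.sum_comm]
          refine Finset.sum_congr rfl fun u' _ => ?_
          rw [Finset.sum_comm]
          refine Finset.sum_congr rfl fun v _ => Finset.sum_congr rfl fun v' _ => ?_
          ring
  exact_mod_cast this

lemma sum_chi_charDist (ψ : NQubit n) (x : Phase n) :
    ∑ y, chi (symp x y) * charDist ψ y = 2 ^ n * charDist ψ x := by
  rw [two_pow_mul_charDist]
  simp only [charDist_eq, mul_div_assoc', ← Finset.sum_div, sum_chi_weylExp_sq]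
  field_simp

lemma sum_charDist {ψ : NQubit n} (hψ : ‖ψ‖ = 1) : ∑ x, charDist ψ x = 1 := by
  have h := sum_chi_charDist ψ 0
  rw [two_pow_mul_charDist, weylExp_zero hψ] at h
  simpa [symp] using h

lemma sum_chi_symp (y : Phase n) : ∑ x, chi (symp x y) = if y = 0 then 4 ^ n else 0 := by
  simp only [symp, chi_sum]
  rw [sum_phase_prod fun i p => chi (p.1 * y.2 i + p.2 * y.1 i)]
  have h1 : ∀ a b : ZMod 2, ∑ p : ZMod 2 × ZMod 2, chi (p.1 * b + p.2 * a) =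
      if a = 0 ∧ b = 0 then 4 else 0 := by
    simp only [Fintype.sum_prod_type, sum_zmod_two]
    simp [forall_zmod_two, zmod_two_one_add_one]
    norm_num
  simp only [h1, Finset.prod_ite_zero, Finset.prod_const, Finset.card_univ, Fintype.card_fin]
  refine if_congr ?_ rfl rfl
  simp only [Finset.mem_univ, forall_const, Prod.ext_iff, funext_iff, forall_and]
  rfl

/-- The autocorrelation of a symplectic Fourier transform is the transform of the square. -/
lemma sum_fourier_mul_fourier (f : Phase n → ℝ) (z : Phase n) :
    ∑ x, (∑ y, chi (symp x y) * f y) * (∑ y, chi (symp (x + z) y) * f y) =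
      4 ^ n * ∑ y, chi (symp z y) * f y ^ 2 := by
  calc _ = ∑ x, ∑ y, ∑ y', (chi (symp z y') * f y * f y') * chi (symp x (y + y')) := by
        refine Finset.sum_congr rfl fun x _ => ?_
        rw [Finset.sum_mul]
        refine Finset.sum_congr rfl fun y _ => ?_
        rw [Finset.mul_sum]
        refine Finset.sum_congr rfl fun y' _ => ?_
        rw [symp_add_left, symp_add_right, chi_add, chi_add]
        ring
    _ = ∑ y, ∑ y', (chi (symp z y') * f y * f y') * ∑ x, chi (symp x (y + y')) := by
        rw [Finset.sum_comm]
        refine Finset.sum_congr rfl fun y _ => ?_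
        rw [Finset.sum_comm]
        simp only [Finset.mul_sum]
    _ = _ := by
        rw [Finset.mul_sum]
        refine Finset.sum_congr rfl fun y _ => ?_
        have h0 : ∀ y' : Phase n, y + y' = 0 ↔ y = y' := fun y' => by
          rw [add_eq_zero_iff_eq_neg]
          simp only [Prod.ext_iff, funext_iff, Prod.fst_neg, Prod.snd_neg, Pi.neg_apply,
            CharTwo.neg_eq]
        simp only [sum_chi_symp, h0, mul_ite, mul_zero, Finset.sum_ite_eq, Finset.mem_univ, if_true]
        ring

lemma weylDist_eq_fourier (ψ : NQubit n) (z : Phase n) :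
    weylDist ψ z = ∑ y, chi (symp z y) * charDist ψ y ^ 2 := by
  have h := sum_fourier_mul_fourier (charDist ψ) z
  simp only [sum_chi_charDist] at h
  have h3 : ∑ x, 2 ^ n * charDist ψ x * (2 ^ n * charDist ψ (x + z)) = 4 ^ n * weylDist ψ z := by
    rw [weylDist, Finset.mul_sum]
    refine Finset.sum_congr rfl fun x _ => ?_
    rw [← two_pow_mul_two_pow, add_comm z]; ring
  rw [h3] at h
  exact mul_left_cancel₀ (by positivity) h

lemma eta_eq_sum_charDist_cube (ψ : NQubit n) : eta ψ = 4 ^ n * ∑ x, charDist ψ x ^ 3 := by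
  calc eta ψ = ∑ z, ∑ y, charDist ψ y ^ 2 * 2 ^ n * (chi (symp y z) * charDist ψ z) := by
        refine Finset.sum_congr rfl fun z _ => ?_
        rw [weylDist_eq_fourier, Finset.sum_mul]
        refine Finset.sum_congr rfl fun y _ => ?_
        rw [symp_comm]; ring
    _ = _ := by
        rw [Finset.sum_comm, Finset.mul_sum]
        refine Finset.sum_congr rfl fun y _ => ?_
        rw [← Finset.mul_sum, sum_chi_charDist, ← two_pow_mul_two_pow]; ring

lemma eta_eq_sum_weylExp (ψ : NQubit n) : eta ψ = ∑ x, charDist ψ x * weylExp ψ x ^ 4 := by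
  rw [eta_eq_sum_charDist_cube, Finset.mul_sum]
  refine Finset.sum_congr rfl fun x _ => ?_
  have h : weylExp ψ x ^ 4 = (weylExp ψ x ^ 2) ^ 2 := by ring
  rw [h, ← two_pow_mul_charDist, ← two_pow_mul_two_pow]; ring

lemma eta_nonneg (ψ : NQubit n) : 0 ≤ eta ψ := by
  rw [eta_eq_sum_weylExp]
  exact Finset.sum_nonneg fun x _ => mul_nonneg (charDist_nonneg ψ x) (by positivity)

lemma eta_le_one {ψ : NQubit n} (hψ : ‖ψ‖ = 1) : eta ψ ≤ 1 := by
  rw [eta_eq_sum_weylExp, ← sum_charDist hψ]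
  refine Finset.sum_le_sum fun x _ => mul_le_of_le_one_right (charDist_nonneg ψ x) ?_
  rw [← Even.pow_abs (by decide)]
  exact pow_le_one₀ (abs_nonneg _) (abs_weylExp_le_one hψ x)

/-- The distribution of the outcome of a Bell measurement of two copies of `ψ`: the symplectic
Fourier transform of `2^{-n} p_ψ` twisted by the signs `(-1)^{a·b}`, which record that transposing
`W_{(a,b)}` multiplies it by `(-1)^{a·b}`. -/
def bellDist (ψ : NQubit n) (x : Phase n) : ℝ :=
  ∑ y : Phase n, chi (symp x y) * (chi (∑ i, y.1 i * y.2 i) * (charDist ψ y / 2 ^ n))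

/-- Bell difference sampling samples from `q_ψ`: the signs in the Bell distribution square to one,
so that it has the same autocorrelation as `p_ψ`. -/
lemma sum_bellDist_mul_bellDist (ψ : NQubit n) (z : Phase n) :
    ∑ x, bellDist ψ x * bellDist ψ (x + z) = weylDist ψ z := by
  simp only [bellDist]
  rw [sum_fourier_mul_fourier, weylDist_eq_fourier, Finset.mul_sum]
  refine Finset.sum_congr rfl fun y _ => ?_
  rw [mul_pow, sq (chi (∑ i, y.1 i * y.2 i)), chi_mul_self,
    ← two_pow_mul_two_pow]
  field_simp

lemma sum_weylDist {ψ : NQubit n} (hψ : ‖ψ‖ = 1) : ∑ x, weylDist ψ x = 1 := by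
  simp only [weylDist]
  rw [Finset.sum_comm]
  simp only [← Finset.mul_sum]
  have h : ∀ y : Phase n, ∑ x, charDist ψ (x + y) = 1 := fun y => by
    rw [← sum_charDist hψ]
    exact Equiv.sum_comp (Equiv.addRight y) (charDist ψ)
  simp only [h, mul_one, sum_charDist hψ]

/-! ### Averaging over a stabilizer group -/

/-- The multiplicative group in which stabilizer groups live. -/
abbrev UMat (n : ℕ) : Type := (Matrix (Fin n → ZMod 2) (Fin n → ZMod 2) ℂ)ˣ

/-- The action of an invertible matrix on states. -/
abbrev unitMap (g : UMat n) : NQubit n →ₗ[ℂ] NQubit n :=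
  Matrix.toEuclideanLin (g : Matrix (Fin n → ZMod 2) (Fin n → ZMod 2) ℂ)

lemma unitMap_mul (g h : UMat n) (φ : NQubit n) : unitMap (g * h) φ = unitMap g (unitMap h φ) :=
  toEuclideanLin_mul_apply _ _ φ

lemma unitMap_one (φ : NQubit n) : unitMap 1 φ = φ := toEuclideanLin_one_apply φ

lemma unitMap_inv_unitMap (g : UMat n) (φ : NQubit n) : unitMap g⁻¹ (unitMap g φ) = φ := by
  rw [← unitMap_mul, inv_mul_cancel, unitMap_one]

/-- Every element of `G` is, up to a power of `i`, a Weyl operator. -/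
def IsPauli (G : Subgroup (UMat n)) : Prop :=
  ∀ g ∈ G, ∃ (k : ℕ) (x : Phase n),
    (g : Matrix (Fin n → ZMod 2) (Fin n → ZMod 2) ℂ) = I ^ k • weyl x

lemma unitMap_eq {g : UMat n} {k : ℕ} {x : Phase n}
    (h : (g : Matrix (Fin n → ZMod 2) (Fin n → ZMod 2) ℂ) = I ^ k • weyl x) (φ : NQubit n) :
    unitMap g φ = I ^ k • weylMap x φ := by
  rw [unitMap, h, map_smul, LinearMap.smul_apply]

/-- Pauli operators are unitary. -/
lemma IsPauli.inner_unitMap {G : Subgroup (UMat n)} (hG : IsPauli G) {g : UMat n} (hg : g ∈ G)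
    (φ χ : NQubit n) : inner ℂ (unitMap g φ) χ = inner ℂ φ (unitMap g⁻¹ χ) := by
  obtain ⟨k, x, hk⟩ := hG g hg
  have h : ∀ φ χ : NQubit n, inner ℂ (unitMap g φ) (unitMap g χ) = inner ℂ φ χ := fun φ χ => by
    rw [unitMap_eq hk, unitMap_eq hk, inner_smul_left, inner_smul_right,
      weylMap_isSymmetric, weylMap_weylMap, ← mul_assoc, ← Complex.normSq_eq_conj_mul_self]
    simp
  rw [← h φ, ← unitMap_mul, mul_inv_cancel, unitMap_one]

/-- The average of `g φ` over `g ∈ G`: the orthogonal projection of `φ` to the vectors fixed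
by `G`. -/
def groupAvg (G : Subgroup (UMat n)) [Fintype G] (φ : NQubit n) : NQubit n :=
  (Fintype.card G : ℂ)⁻¹ • ∑ g : G, unitMap (g : UMat n) φ

section Average

variable {G : Subgroup (UMat n)} [Fintype G]

lemma unitMap_groupAvg {h : UMat n} (hh : h ∈ G) (φ : NQubit n) :
    unitMap h (groupAvg G φ) = groupAvg G φ := by
  rw [groupAvg, map_smul, map_sum]
  congr 1
  simp only [← unitMap_mul]
  exact Equiv.sum_comp (Equiv.mulLeft (⟨h, hh⟩ : G)) fun g : G => unitMap (g : UMat n) φ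

lemma IsPauli.inner_groupAvg_of_fixed (hG : IsPauli G) {φ : NQubit n}
    (hφ : ∀ g ∈ G, unitMap g φ = φ) (ψ : NQubit n) :
    inner ℂ φ (groupAvg G ψ) = inner ℂ φ ψ := by
  have h : ∀ g : G, inner ℂ φ (unitMap (g : UMat n) ψ) = inner ℂ φ ψ := fun g => by
    have := hG.inner_unitMap (G.inv_mem g.2) φ ψ
    rw [inv_inv] at this
    rw [← this, hφ _ (G.inv_mem g.2)]
  rw [groupAvg, inner_smul_right, inner_sum]
  simp only [h, Finset.sum_const, Finset.card_univ, nsmul_eq_mul]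
  have : (Fintype.card G : ℂ) ≠ 0 := by exact_mod_cast Fintype.card_ne_zero
  field_simp

lemma IsPauli.inner_groupAvg_self (hG : IsPauli G) (ψ : NQubit n) :
    inner ℂ (groupAvg G ψ) ψ = ((‖groupAvg G ψ‖ ^ 2 : ℝ) : ℂ) := by
  rw [← hG.inner_groupAvg_of_fixed (fun g hg => unitMap_groupAvg hg ψ),
    inner_self_eq_norm_sq_to_K]
  simp

lemma IsPauli.norm_groupAvg_sq (hG : IsPauli G) (ψ : NQubit n) :
    ((‖groupAvg G ψ‖ ^ 2 : ℝ) : ℂ) =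
      (Fintype.card G : ℂ)⁻¹ * ∑ g : G, inner ℂ ψ (unitMap (g : UMat n) ψ) := by
  rw [← Complex.conj_ofReal, ← hG.inner_groupAvg_self, inner_conj_symm, groupAvg,
    inner_smul_right, inner_sum]

end Average

/-! ### The statistic is at least the sixth power of the stabilizer fidelity -/

/-- The projection to the stabilized space dominates the stabilizer state, and is the average of
`2^n` Weyl operators, which are distinct since `φ ≠ 0` is fixed; the power mean inequality
then compares with `η = 2^{-n} ∑_x ⟨W_x⟩^6`. -/
lemma fidelity_pow_six_le_eta {φ : NQubit n} (hφ : IsStabilizerState φ) (ψ : NQubit n) :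
    (‖inner ℂ φ ψ‖ ^ 2) ^ 6 ≤ eta ψ := by
  obtain ⟨hnorm, G, hG, -, hcard, hfix⟩ := hφ
  have hP : IsPauli G := hG
  have : Finite G := Nat.finite_of_card_ne_zero (by rw [hcard]; positivity)
  have : Fintype G := Fintype.ofFinite G
  rw [Nat.card_eq_fintype_card] at hcard
  choose k x hk using fun g : G => hG g g.2
  have hinj : Function.Injective x := fun g h hgh => by
    have hg := unitMap_eq (hk g) φ
    have hh := unitMap_eq (hk h) φ
    rw [hfix g g.2] at hg
    rw [hfix h h.2, ← hgh] at hh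
    have hne : weylMap (x g) φ ≠ 0 := by
      rw [← norm_ne_zero_iff, norm_weylMap, hnorm]; exact one_ne_zero
    have hI : I ^ k g = I ^ k h := smul_left_injective ℂ hne (hg.symm.trans hh)
    exact Subtype.ext (Units.ext (by rw [hk g, hk h, hgh, hI]))
  have h1 : ‖inner ℂ φ ψ‖ ^ 2 ≤ ‖groupAvg G ψ‖ ^ 2 := by
    rw [← hP.inner_groupAvg_of_fixed hfix]
    gcongr
    simpa [hnorm] using norm_inner_le_norm (𝕜 := ℂ) φ (groupAvg G ψ)
  have h2 : ‖groupAvg G ψ‖ ^ 2 ≤ ∑ g : G, ((2 : ℝ) ^ n)⁻¹ * |weylExp ψ (x g)| := by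
    have h := congrArg norm (hP.norm_groupAvg_sq ψ)
    rw [Complex.norm_real, Real.norm_of_nonneg (by positivity), norm_mul, norm_inv, hcard] at h
    rw [h, ← Finset.mul_sum]
    have h2n : ‖(((2 ^ n : ℕ) : ℂ))‖ = 2 ^ n := by simp
    rw [h2n]
    gcongr
    refine (norm_sum_le _ _).trans (Finset.sum_le_sum fun g _ => ?_)
    rw [unitMap_eq (hk g), inner_smul_right, norm_mul, norm_inner_weylMap]
    simp
  calc (‖inner ℂ φ ψ‖ ^ 2) ^ 6 ≤ (∑ g : G, ((2 : ℝ) ^ n)⁻¹ * |weylExp ψ (x g)|) ^ 6 := by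
        gcongr
        exact h1.trans h2
    _ ≤ ∑ g : G, ((2 : ℝ) ^ n)⁻¹ * |weylExp ψ (x g)| ^ 6 := by
        refine Real.pow_arith_mean_le_arith_mean_pow _ _ _ (fun _ _ => by positivity) ?_
          (fun _ _ => abs_nonneg _) 6
        rw [Finset.sum_const, Finset.card_univ, hcard, nsmul_eq_mul]
        push_cast
        field_simp
    _ ≤ ∑ y : Phase n, ((2 : ℝ) ^ n)⁻¹ * |weylExp ψ y| ^ 6 := by
        refine (Finset.sum_map Finset.univ ⟨x, hinj⟩
          fun y : Phase n => ((2 : ℝ) ^ n)⁻¹ * |weylExp ψ y| ^ 6).symm.trans_le ?_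
        exact Finset.sum_le_univ_sum_of_nonneg fun y => by positivity
    _ = eta ψ := by
        rw [eta_eq_sum_weylExp]
        refine Finset.sum_congr rfl fun y _ => ?_
        rw [charDist_eq, Even.pow_abs (by decide)]
        ring

lemma stabFidelity_pow_six_le_eta (ψ : NQubit n) : stabFidelity ψ ^ 6 ≤ eta ψ := by
  have h0 : 0 ≤ stabFidelity ψ := Real.sSup_nonneg (by rintro _ ⟨φ, -, rfl⟩; positivity)
  have h : stabFidelity ψ ≤ eta ψ ^ ((6 : ℕ) : ℝ)⁻¹ := by
    refine Real.sSup_le ?_ (Real.rpow_nonneg (eta_nonneg ψ) _)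
    rintro _ ⟨φ, hφ, rfl⟩
    rw [Real.le_rpow_inv_iff_of_pos (by positivity) (eta_nonneg ψ) (by norm_num),
      Real.rpow_natCast]
    exact fidelity_pow_six_le_eta hφ ψ
  calc stabFidelity ψ ^ 6 ≤ (eta ψ ^ ((6 : ℕ) : ℝ)⁻¹) ^ 6 := by gcongr
    _ = eta ψ := Real.rpow_inv_natCast_pow (eta_nonneg ψ) (by norm_num)

lemma le_stabFidelity {φ ψ : NQubit n} (hφ : IsStabilizerState φ) (hψ : ‖ψ‖ = 1) :
    ‖inner ℂ φ ψ‖ ^ 2 ≤ stabFidelity ψ := by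
  refine le_csSup ⟨1, ?_⟩ ⟨φ, hφ, rfl⟩
  rintro _ ⟨χ, hχ, rfl⟩
  refine pow_le_one₀ (norm_nonneg _) ((norm_inner_le_norm _ _).trans ?_)
  rw [hχ.1, hψ, one_mul]

/-! ### Self-dual sets of Weyl operators and their joint eigenvectors -/

lemma eq_zero_of_symp_eq_zero {x : Phase n} (h : ∀ y, symp y x = 0) : x = 0 := by
  by_contra hx
  have h1 := sum_chi_symp x
  simp only [h, chi_zero, hx, if_false, Finset.sum_const, nsmul_eq_mul, mul_one] at h1
  exact Finset.card_ne_zero.2 (Finset.univ_nonempty (α := Phase n)) (by exact_mod_cast h1)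

/-- A set that consists of exactly the elements symplectically orthogonal to it has `2^n`
elements. -/
lemma natCard_of_selfDual {T : Set (Phase n)} (hT : ∀ y, y ∈ T ↔ ∀ x ∈ T, symp x y = 0) :
    Nat.card T = 2 ^ n := by
  have hs : ∀ (c : ZMod 2) (x y : Phase n), symp (c • x) y = c * symp x y := fun c x y => by
    rw [symp, symp, Finset.mul_sum]
    exact Finset.sum_congr rfl fun i _ => by
      simp only [Prod.smul_fst, Prod.smul_snd, Pi.smul_apply, smul_eq_mul]; ring
  let B : LinearMap.BilinForm (ZMod 2) (Phase n) :=
    LinearMap.mk₂ (ZMod 2) symp symp_add_left hs symp_add_right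
      (fun c x y => by rw [symp_comm, hs, symp_comm]; rfl)
  have hB : B.Nondegenerate := by
    refine ⟨fun x hx => eq_zero_of_symp_eq_zero fun y => ?_, fun y hy =>
      eq_zero_of_symp_eq_zero fun x => hy x⟩
    rw [symp_comm]; exact hx y
  let W : Submodule (ZMod 2) (Phase n) :=
    { carrier := T
      add_mem' := fun {a b} ha hb => (hT _).2 fun x hx => by
        rw [symp_add_right, (hT a).1 ha x hx, (hT b).1 hb x hx, add_zero]
      zero_mem' := (hT 0).2 fun x _ => by simp [symp]
      smul_mem' := fun c a ha => (hT _).2 fun x hx => by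
        rw [symp_comm, hs, symp_comm, (hT a).1 ha x hx, mul_zero] }
  have hW : B.orthogonal W = W := by
    ext y
    rw [LinearMap.BilinForm.mem_orthogonal_iff]
    exact (hT y).symm
  have h1 := LinearMap.BilinForm.finrank_orthogonal hB W
  have h2 : Module.finrank (ZMod 2) (Phase n) = n + n := by
    rw [Module.finrank_prod, Module.finrank_fin_fun]
  have h3 := Submodule.finrank_le W
  rw [hW] at h1
  have h4 : Module.finrank (ZMod 2) W = n := by omega
  have h5 : Nat.card W = 2 ^ n := by
    rw [Module.natCard_eq_pow_finrank (K := ZMod 2), h4, Nat.card_zmod]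
  exact h5

lemma weyl_ne_zero (x : Phase n) : weyl x ≠ 0 := fun h => by
  have := weyl_mul_self x
  rw [h, zero_mul] at this
  exact zero_ne_one this

/-- Distinct Weyl operators are not proportional, since they have different commutation
relations. -/
lemma eq_of_weyl_eq_smul {x y : Phase n} {c : ℂ} (h : weyl x = c • weyl y) : x = y := by
  have hc : c ≠ 0 := fun hc => weyl_ne_zero x (by rw [h, hc, zero_smul])
  have key : ∀ z, symp z (x + y) = 0 := fun z => by
    have h1 := weyl_mul_comm z x
    rw [h, Matrix.mul_smul, Matrix.smul_mul, weyl_mul_comm z y] at h1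
    have h2 : weyl y * weyl z ≠ 0 := fun h0 => weyl_ne_zero z (by
      rw [← one_mul (weyl z), ← weyl_mul_self y, mul_assoc, h0, mul_zero])
    rw [smul_smul, smul_smul] at h1
    have h3 := smul_left_injective ℂ h2 h1
    have h4 : chi (symp z y) = chi (symp z x) := by
      rw [mul_comm] at h3
      exact_mod_cast mul_right_cancel₀ hc h3
    rw [← chi_eq_one_iff, symp_add_right, chi_add, h4, chi_mul_self]
  have := eq_zero_of_symp_eq_zero key
  rw [add_eq_zero_iff_eq_neg] at this
  rw [this]
  simp only [Prod.ext_iff, funext_iff, Prod.fst_neg, Prod.snd_neg, Pi.neg_apply,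
    CharTwo.neg_eq, implies_true, and_self]

/-- Let `v` be a joint eigenvector of the Weyl operators of a self-dual set `T`. The operators
`i^k W_x`, `x ∈ T`, that fix `v` form a stabilizer group. The projection of `ψ` to its fixed
space, normalised, is a stabilizer state. -/
lemma sum_eigenvalue_mul_weylExp_le {T : Set (Phase n)} [Fintype T]
    (hT : ∀ y, y ∈ T ↔ ∀ x ∈ T, symp x y = 0) {v : NQubit n} (hv : v ≠ 0) {a : T → ℂ}
    (ha : ∀ x : T, weylMap (x : Phase n) v = a x • v) {ψ : NQubit n} (hψ : ‖ψ‖ = 1) :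
    ∑ x : T, (a x).re * weylExp ψ x ≤ 2 ^ n * stabFidelity ψ := by
  have hcardT := natCard_of_selfDual hT
  -- The eigenvalues are signs because `W_x² = 1`.
  have haa : ∀ x, a x * a x = 1 := fun x => by
    have h := weylMap_weylMap (x : Phase n) v
    rw [ha, map_smul, ha, smul_smul] at h
    exact smul_left_injective ℂ hv (by simpa using h)
  have hadd : ∀ x ∈ T, ∀ y ∈ T, x + y ∈ T := fun x hx y hy => (hT _).2 fun z hz => by
    rw [symp_add_right, (hT x).1 hx z hz, (hT y).1 hy z hz, add_zero]
  have hzero : (0 : Phase n) ∈ T := (hT 0).2 fun x _ => by simp [symp]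
  let G : Subgroup (UMat n) :=
    { carrier := {g | (∃ (k : ℕ) (x : T),
        (g : Matrix (Fin n → ZMod 2) (Fin n → ZMod 2) ℂ) = I ^ k • weyl (x : Phase n)) ∧
          unitMap g v = v}
      mul_mem' := by
        rintro g h ⟨⟨k, x, hg⟩, hgv⟩ ⟨⟨l, y, hh⟩, hhv⟩
        obtain ⟨m, hm⟩ := weyl_mul (x : Phase n) y
        refine ⟨⟨k + l + m, ⟨x + y, hadd x x.2 y y.2⟩, ?_⟩, by rw [unitMap_mul, hhv, hgv]⟩
        rw [Units.val_mul, hg, hh, Matrix.smul_mul, Matrix.mul_smul, hm, smul_smul, smul_smul,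
          pow_add, pow_add, mul_assoc]
      one_mem' := ⟨⟨0, ⟨0, hzero⟩, by rw [weyl_zero, pow_zero, one_smul, Units.val_one]⟩,
        unitMap_one v⟩
      inv_mem' := by
        rintro g ⟨⟨k, x, hg⟩, hgv⟩
        refine ⟨⟨3 * k, x, Units.inv_eq_of_mul_eq_one_right ?_⟩, ?_⟩
        · have hI : I ^ k * I ^ (3 * k) = 1 := by
            rw [← pow_add, show k + 3 * k = 4 * k by ring, pow_mul, I_pow_four, one_pow]
          rw [hg, Matrix.smul_mul, Matrix.mul_smul, weyl_mul_self, smul_smul, hI, one_smul]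
        · conv_lhs => rw [← hgv]
          exact unitMap_inv_unitMap g v }
  have hP : IsPauli G := fun g hg => by
    obtain ⟨⟨k, x, h⟩, -⟩ := hg
    exact ⟨k, x, h⟩
  have hunit : ∀ x : T, (a x • weyl (x : Phase n)) * (a x • weyl (x : Phase n)) = 1 := fun x => by
    rw [Matrix.smul_mul, Matrix.mul_smul, smul_smul, haa, weyl_mul_self, one_smul]
  let u : T → UMat n := fun x => ⟨a x • weyl (x : Phase n), a x • weyl (x : Phase n),
    hunit x, hunit x⟩
  have hu : ∀ x : T, u x ∈ G := fun x => by
    refine ⟨?_, ?_⟩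
    · rcases mul_self_eq_one_iff.1 (haa x) with h | h
      · exact ⟨0, x, by simp only [u, h, pow_zero]⟩
      · exact ⟨2, x, by simp only [u, h, I_sq]⟩
    · simp only [unitMap, u, map_smul, LinearMap.smul_apply]
      rw [show Matrix.toEuclideanLin (weyl (x : Phase n)) v = a x • v from ha x,
        smul_smul, haa, one_smul]
  -- Among the operators `i^k W_x` with `x` fixed, only `a x W_x` fixes `v`; so `G` has the size
  -- of `T`.
  let f : T → G := fun x => ⟨u x, hu x⟩
  have hf : Function.Bijective f := by
    constructor
    · intro x y hxy
      have h : a x • weyl (x : Phase n) = a y • weyl (y : Phase n) :=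
        congrArg (fun g : G => ((g : UMat n) : Matrix (Fin n → ZMod 2) (Fin n → ZMod 2) ℂ)) hxy
      refine Subtype.ext (eq_of_weyl_eq_smul (c := a x * a y) ?_)
      rw [← smul_smul, ← h, smul_smul, haa, one_smul]
    · rintro ⟨g, ⟨k, x, hg⟩, hgv⟩
      refine ⟨x, Subtype.ext (Units.ext ?_)⟩
      have h1 : I ^ k * a x = 1 := by
        rw [unitMap_eq hg, ha, smul_smul] at hgv
        exact smul_left_injective ℂ hv (by simpa using hgv)
      have h2 : I ^ k = a x := by
        rw [← mul_one (I ^ k), ← haa x, ← mul_assoc, h1, one_mul]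
      change a x • weyl (x : Phase n) = (g : Matrix (Fin n → ZMod 2) (Fin n → ZMod 2) ℂ)
      rw [hg, h2]
  let e : T ≃ G := Equiv.ofBijective f hf
  have : Fintype G := Fintype.ofEquiv T e
  have hcard : Fintype.card G = 2 ^ n := by
    rw [← hcardT, Nat.card_eq_fintype_card, Fintype.card_congr e]
  have hsum : ((‖groupAvg G ψ‖ ^ 2 : ℝ) : ℂ) =
      (((2 : ℝ) ^ n)⁻¹ : ℝ) * ∑ x : T, a x * weylExp ψ x := by
    rw [hP.norm_groupAvg_sq, hcard, ← e.sum_comp]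
    push_cast
    congr 1
    refine Finset.sum_congr rfl fun x _ => ?_
    rw [ofReal_weylExp, ← inner_smul_right]
    simp only [e, f, u, unitMap, Equiv.ofBijective_apply, map_smul, LinearMap.smul_apply]
  have hsum' : ‖groupAvg G ψ‖ ^ 2 = ((2 : ℝ) ^ n)⁻¹ * ∑ x : T, (a x).re * weylExp ψ x := by
    have := congrArg Complex.re hsum
    rw [Complex.ofReal_re, Complex.re_ofReal_mul, Complex.re_sum] at this
    simpa only [Complex.re_mul_ofReal] using this
  suffices h : ‖groupAvg G ψ‖ ^ 2 ≤ stabFidelity ψ by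
    rw [hsum', inv_mul_le_iff₀ (by positivity)] at h
    exact h
  by_cases h0 : groupAvg G ψ = 0
  · rw [h0, norm_zero, zero_pow two_ne_zero]
    exact Real.sSup_nonneg (by rintro _ ⟨φ, -, rfl⟩; positivity)
  have hne : ‖groupAvg G ψ‖ ≠ 0 := norm_ne_zero_iff.2 h0
  let φ : NQubit n := (((‖groupAvg G ψ‖)⁻¹ : ℝ) : ℂ) • groupAvg G ψ
  have hφ : IsStabilizerState φ := by
    refine ⟨?_, G, hP, ?_, by rw [Nat.card_eq_fintype_card, hcard], fun g hg => ?_⟩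
    · rw [norm_smul, Complex.norm_real, norm_inv, norm_norm, inv_mul_cancel₀ hne]
    · rintro g ⟨⟨k, x, hg⟩, -⟩ h ⟨⟨l, y, hh⟩, -⟩
      refine Units.ext ?_
      rw [Units.val_mul, Units.val_mul, hg, hh, Matrix.smul_mul, Matrix.mul_smul, Matrix.smul_mul,
        Matrix.mul_smul, weyl_mul_comm, (hT y).1 y.2 x x.2, chi_zero, Complex.ofReal_one, one_smul,
        smul_comm]
    · exact (map_smul (unitMap g) _ _).trans (by rw [unitMap_groupAvg hg])
  have hval : ‖inner ℂ φ ψ‖ ^ 2 = ‖groupAvg G ψ‖ ^ 2 := by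
    rw [inner_smul_left, hP.inner_groupAvg_self, norm_mul, RCLike.norm_conj, Complex.norm_real,
      Complex.norm_real, norm_inv, norm_norm, Real.norm_of_nonneg (by positivity)]
    field_simp
  rw [← hval]
  exact le_stabFidelity hφ hψ

/-- The mass that `p_ψ` gives to a self-dual set is at most the stabilizer fidelity: decompose `ψ`
into joint eigenvectors. -/
lemma sum_charDist_le_stabFidelity {T : Set (Phase n)} [Fintype T]
    (hT : ∀ y, y ∈ T ↔ ∀ x ∈ T, symp x y = 0) {ψ : NQubit n} (hψ : ‖ψ‖ = 1) :
    ∑ x : T, charDist ψ x ≤ stabFidelity ψ := by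
  have hsymm : ∀ x : T, (weylMap (x : Phase n)).IsSymmetric := fun x => weylMap_isSymmetric _
  have hcomm : Pairwise (Function.onFun Commute fun x : T => weylMap (x : Phase n)) := by
    intro x y _
    ext1 φ
    change weylMap (x : Phase n) (weylMap (y : Phase n) φ) =
      weylMap (y : Phase n) (weylMap (x : Phase n) φ)
    rw [← toEuclideanLin_mul_apply, weyl_mul_comm, (hT y).1 y.2 x x.2, chi_zero,
      Complex.ofReal_one, one_smul, toEuclideanLin_mul_apply]
  have htop := LinearMap.IsSymmetric.iSup_iInf_eq_top_of_commute hsymm hcomm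
  have horth := LinearMap.IsSymmetric.orthogonalFamily_iInf_eigenspaces hsymm
  obtain ⟨c, hc, hsum⟩ := (Submodule.mem_iSup_iff_exists_finsupp _ ψ).1
    (htop ▸ Submodule.mem_top : ψ ∈ _)
  rw [Finsupp.sum] at hsum
  have heig : ∀ (a : T → ℂ) (x : T), weylMap (x : Phase n) (c a) = a x • c a := fun a x =>
    Module.End.mem_eigenspace_iff.1 ((Submodule.mem_iInf _).1 (hc a) x)
  have hort : ∀ a b, a ≠ b → inner ℂ (c a) (c b) = 0 := fun a b hab =>
    horth hab ⟨c a, hc a⟩ ⟨c b, hc b⟩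
  have hinner : ∀ a ∈ c.support, inner ℂ ψ (c a) = ((‖c a‖ ^ 2 : ℝ) : ℂ) := fun a ha => by
    conv_lhs => rw [← hsum]
    rw [sum_inner, Finset.sum_eq_single a (fun b _ hb => hort b a hb) (fun h => absurd ha h),
      inner_self_eq_norm_sq_to_K]
    simp
  have hone : ∑ a ∈ c.support, ‖c a‖ ^ 2 = 1 := by
    have h : inner ℂ ψ ψ = ∑ a ∈ c.support, inner ℂ ψ (c a) := by
      conv_lhs => rw [← hsum, inner_sum]
      rw [hsum]
    rw [Finset.sum_congr rfl hinner, inner_self_eq_norm_sq_to_K, hψ] at h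
    have h' : ((∑ a ∈ c.support, ‖c a‖ ^ 2 : ℝ) : ℂ) = ((1 : ℝ) : ℂ) := by
      rw [Complex.ofReal_sum, ← h]; simp
    exact_mod_cast h'
  have hexp : ∀ x : T, weylExp ψ x = ∑ a ∈ c.support, ‖c a‖ ^ 2 * (a x).re := fun x => by
    have h : inner ℂ ψ (weylMap (x : Phase n) ψ) =
        ∑ a ∈ c.support, ((‖c a‖ ^ 2 : ℝ) : ℂ) * a x := by
      conv_lhs => rw [← hsum, map_sum, inner_sum]
      rw [hsum]
      refine Finset.sum_congr rfl fun a ha => ?_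
      rw [heig, inner_smul_right, hinner a ha, mul_comm]
    rw [weylExp, h, Complex.re_sum]
    simp only [Complex.re_ofReal_mul]
  have key : ∑ x : T, weylExp ψ x ^ 2 ≤ 2 ^ n * stabFidelity ψ := by
    calc ∑ x : T, weylExp ψ x ^ 2
        -- Only one factor of the square is expanded in eigenvalues.
        = ∑ a ∈ c.support, ‖c a‖ ^ 2 * ∑ x : T, (a x).re * weylExp ψ x := by
          simp only [Finset.mul_sum]
          rw [Finset.sum_comm]
          refine Finset.sum_congr rfl fun x _ => ?_
          simp only [← mul_assoc]
          rw [← Finset.sum_mul, ← hexp x, sq]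
      _ ≤ ∑ a ∈ c.support, ‖c a‖ ^ 2 * (2 ^ n * stabFidelity ψ) := by
          refine Finset.sum_le_sum fun a ha => ?_
          gcongr
          exact sum_eigenvalue_mul_weylExp_le hT (Finsupp.mem_support_iff.1 ha) (heig a) hψ
      _ = 2 ^ n * stabFidelity ψ := by rw [← Finset.sum_mul, hone, one_mul]
  simp only [charDist_eq, ← Finset.sum_div]
  rw [div_le_iff₀ (by positivity)]
  linarith

/-! ### The statistic is at most a quarter plus three quarters of the stabilizer fidelity -/

/-- Uncertainty principle: two anticommuting Weyl operators cannot both have squared expectation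
above one half. -/
lemma weylExp_sq_add_le_one {ψ : NQubit n} (hψ : ‖ψ‖ = 1) {x y : Phase n}
    (hxy : symp x y ≠ 0) : weylExp ψ x ^ 2 + weylExp ψ y ^ 2 ≤ 1 := by
  have hchi : chi (symp x y) = -1 := by simp [chi, hxy]
  have hanti : inner ℂ (weylMap x ψ) (weylMap y ψ) = -inner ℂ (weylMap y ψ) (weylMap x ψ) := by
    rw [weylMap_isSymmetric, weylMap_isSymmetric, ← toEuclideanLin_mul_apply,
      ← toEuclideanLin_mul_apply, weyl_mul_comm, hchi, map_smul, LinearMap.smul_apply,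
      inner_smul_right]
    simp
  have hre : RCLike.re (inner ℂ (weylMap x ψ) (weylMap y ψ)) = 0 := by
    have h := congrArg RCLike.re hanti
    rw [map_neg, inner_re_symm (𝕜 := ℂ) (weylMap y ψ)] at h
    linarith
  have hre1 : ∀ z, RCLike.re (inner ℂ ψ (weylMap z ψ)) = weylExp ψ z := fun z => rfl
  -- The vector `ψ - ⟨W_x⟩ W_x ψ - ⟨W_y⟩ W_y ψ` has squared norm `1 - ⟨W_x⟩² - ⟨W_y⟩²`.
  have h : ‖ψ - (((weylExp ψ x : ℝ) : ℂ) • weylMap x ψ + ((weylExp ψ y : ℝ) : ℂ) • weylMap y ψ)‖ ^ 2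
      = 1 - (weylExp ψ x ^ 2 + weylExp ψ y ^ 2) := by
    rw [@norm_sub_sq ℂ, @norm_add_sq ℂ, inner_add_right, inner_smul_right, inner_smul_right,
      inner_smul_left, inner_smul_right, norm_smul, norm_smul, norm_weylMap, norm_weylMap, hψ,
      Complex.norm_real, Complex.norm_real, mul_one, mul_one, Real.norm_eq_abs, Real.norm_eq_abs,
      sq_abs, sq_abs, Complex.conj_ofReal, map_add]
    simp only [RCLike.re_eq_complex_re] at hre hre1 ⊢
    simp only [Complex.re_ofReal_mul, hre, hre1]
    ring
  have := sq_nonneg ‖ψ - (((weylExp ψ x : ℝ) : ℂ) • weylMap x ψ +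
    ((weylExp ψ y : ℝ) : ℂ) • weylMap y ψ)‖
  linarith

/-- The Weyl operators with squared expectation above one half commute, hence lie in a self-dual
set `T`; off `T` the weight `⟨W_x⟩⁴` is at most one quarter. -/
lemma eta_le_stabFidelity {ψ : NQubit n} (hψ : ‖ψ‖ = 1) :
    eta ψ ≤ (3 * stabFidelity ψ + 1) / 4 := by
  classical
  have hM : ∀ x ∈ {x | 1 / 2 < weylExp ψ x ^ 2}, ∀ y ∈ {x | 1 / 2 < weylExp ψ x ^ 2},
      symp x y = 0 := fun x hx y hy => by
    by_contra h
    have := weylExp_sq_add_le_one hψ h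
    rw [Set.mem_ofPred_eq] at hx hy
    linarith
  -- A maximal commuting set contains everything that commutes with it.
  obtain ⟨T, hMT, hmax⟩ := Finite.exists_le_maximal
    (p := fun S : Set (Phase n) => ∀ x ∈ S, ∀ y ∈ S, symp x y = 0) hM
  have hT : ∀ y, y ∈ T ↔ ∀ x ∈ T, symp x y = 0 := fun y => by
    refine ⟨fun hy x hx => hmax.prop x hx y hy, fun hy => ?_⟩
    have hins : ∀ a ∈ insert y T, ∀ b ∈ insert y T, symp a b = 0 := by
      rintro a (rfl | ha) b (rfl | hb)
      · exact symp_self _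
      · rw [symp_comm]; exact hy b hb
      · exact hy a ha
      · exact hmax.prop a ha b hb
    exact hmax.le_of_ge hins (Set.subset_insert y T) (Set.mem_insert y T)
  have hle : ∀ x, charDist ψ x * weylExp ψ x ^ 4 ≤
      charDist ψ x * (1 / 4) + if x ∈ T then 3 / 4 * charDist ψ x else 0 := fun x => by
    have h0 := charDist_nonneg ψ x
    split_ifs with hx
    · have h1 : weylExp ψ x ^ 4 ≤ 1 := by
        rw [← Even.pow_abs (by decide)]
        exact pow_le_one₀ (abs_nonneg _) (abs_weylExp_le_one hψ x)
      nlinarith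
    · have h1 : weylExp ψ x ^ 2 ≤ 1 / 2 := not_lt.1 fun h => hx (hMT h)
      have h2 : weylExp ψ x ^ 4 ≤ 1 / 4 := by nlinarith [sq_nonneg (weylExp ψ x)]
      rw [add_zero]
      gcongr
  have hsub : ∑ x, (if x ∈ T then 3 / 4 * charDist ψ x else 0) =
      3 / 4 * ∑ x : T, charDist ψ x := by
    rw [← Finset.sum_filter, Finset.mul_sum]
    exact Finset.sum_subtype _ (by simp) _
  calc eta ψ ≤ ∑ x, (charDist ψ x * (1 / 4) + if x ∈ T then 3 / 4 * charDist ψ x else 0) := by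
        rw [eta_eq_sum_weylExp]
        exact Finset.sum_le_sum fun x _ => hle x
    _ = 1 / 4 + 3 / 4 * ∑ x : T, charDist ψ x := by
        rw [Finset.sum_add_distrib, ← Finset.sum_mul, sum_charDist hψ, hsub, one_mul]
    _ ≤ (3 * stabFidelity ψ + 1) / 4 := by
        have := sum_charDist_le_stabFidelity hT hψ
        linarith

/-! ### Vectors of the quantum memory -/

/-- The basis label of the quantum memory with ancilla bit `t` and the pair `w i` in the `i`-th
qubits of the two registers. -/
def mem (t : ZMod 2) (w : Fin n → ZMod 2 × ZMod 2) : Qubit n → ZMod 2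
  | none => t
  | some (c, i) => if c = 0 then (w i).1 else (w i).2

/-- The component of a memory vector with ancilla bit `t`, a vector of `n` pairs of qubits. -/
def slice (t : ZMod 2) (v : QVec n) : (Fin n → ZMod 2 × ZMod 2) → ℂ := fun w => v (mem t w)

@[simp] lemma mem_none (t : ZMod 2) (w : Fin n → ZMod 2 × ZMod 2) : mem t w none = t := rfl

@[simp] lemma mem_some_zero (t : ZMod 2) (w : Fin n → ZMod 2 × ZMod 2) (i : Fin n) :
    mem t w (some (0, i)) = (w i).1 := rfl

@[simp] lemma mem_some_one (t : ZMod 2) (w : Fin n → ZMod 2 × ZMod 2) (i : Fin n) :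
    mem t w (some (1, i)) = (w i).2 := rfl

/-- The labels of the quantum memory, split into the ancilla bit and the pairs. -/
def memEquiv : ZMod 2 × (Fin n → ZMod 2 × ZMod 2) ≃ (Qubit n → ZMod 2) where
  toFun p := mem p.1 p.2
  invFun u := (u none, fun i => (u (some (0, i)), u (some (1, i))))
  left_inv _ := rfl
  right_inv u := by
    funext q
    rcases q with _ | ⟨c, i⟩
    · rfl
    · fin_cases c <;> rfl

/-- The squared norm of a vector of `n` pairs of qubits. -/
def pairNormSq (a : (Fin n → ZMod 2 × ZMod 2) → ℂ) : ℝ := ∑ w, ‖a w‖ ^ 2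

lemma normSq_eq (v : QVec n) : normSq v = pairNormSq (slice 0 v) + pairNormSq (slice 1 v) := by
  rw [normSq, ← memEquiv.sum_comp, Fintype.sum_prod_type, sum_zmod_two]
  rfl

lemma normSq_nonneg (v : QVec n) : 0 ≤ normSq v := Finset.sum_nonneg fun _ _ => by positivity

lemma pairNormSq_zero : pairNormSq (0 : (Fin n → ZMod 2 × ZMod 2) → ℂ) = 0 := by
  simp [pairNormSq]

lemma ofReal_pairNormSq (a : (Fin n → ZMod 2 × ZMod 2) → ℂ) :
    (pairNormSq a : ℂ) = star a ⬝ᵥ a := by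
  simp only [pairNormSq, dotProduct, Complex.ofReal_sum, Pi.star_apply]
  refine Finset.sum_congr rfl fun w _ => ?_
  rw [← Complex.normSq_eq_norm_sq, Complex.normSq_eq_conj_mul_self]
  rfl

lemma slice_apply1_none (A : Matrix (ZMod 2) (ZMod 2) ℂ) (t : ZMod 2) (v : QVec n) :
    slice t (apply1 A none v) = A t 0 • slice 0 v + A t 1 • slice 1 v := by
  have h : ∀ (w : Fin n → ZMod 2 × ZMod 2) (s : ZMod 2),
      Function.update (mem t w) none s = mem s w := fun w s => by
    funext q
    rcases q with _ | ⟨c, i⟩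
    · simp
    · simp [mem]
  funext w
  simp only [slice, apply1, h, sum_zmod_two, mem_none, Pi.add_apply, Pi.smul_apply, smul_eq_mul]

lemma update_mem_zero (t : ZMod 2) (w : Fin n → ZMod 2 × ZMod 2) (i : Fin n) (s : ZMod 2) :
    Function.update (mem t w) (some (0, i)) s = mem t (Function.update w i (s, (w i).2)) := by
  funext q
  rcases q with _ | ⟨c, j⟩
  · simp
  · by_cases hj : j = i
    · subst hj
      fin_cases c <;> simp [mem]
    · fin_cases c <;> simp [mem, hj, Function.update_of_ne]

lemma update_mem_one (t : ZMod 2) (w : Fin n → ZMod 2 × ZMod 2) (i : Fin n) (s : ZMod 2) :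
    Function.update (mem t w) (some (1, i)) s = mem t (Function.update w i ((w i).1, s)) := by
  funext q
  rcases q with _ | ⟨c, j⟩
  · simp
  · by_cases hj : j = i
    · subst hj
      fin_cases c <;> simp [mem]
    · fin_cases c <;> simp [mem, hj, Function.update_of_ne]

/-- The operator `K` acting on the `i`-th factor. -/
def single {P : Type*} [DecidableEq P] (i : Fin n) (K : Matrix P P ℂ) : Fin n → Matrix P P ℂ :=
  Function.update (fun _ => 1) i K

lemma tensor_single_mulVec {P : Type*} [Fintype P] [DecidableEq P] (i : Fin n) (K : Matrix P P ℂ)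
    (a : (Fin n → P) → ℂ) (u : Fin n → P) :
    (tensor (single i K) *ᵥ a) u = ∑ p, K (u i) p * a (Function.update u i p) := by
  have h : ∀ w, tensor (single i K) u w =
      ∑ p, if w = Function.update u i p then K (u i) p else 0 := fun w => by
    rw [tensor_apply]
    by_cases hw : w = Function.update u i (w i)
    · rw [Finset.prod_eq_single i, Finset.sum_eq_single (w i)]
      · rw [if_pos hw, single, Function.update_self]
      · intro p _ hp
        rw [if_neg]
        intro h'
        exact hp (by rw [h', Function.update_self])
      · simp
      · intro j _ hj
        rw [single, Function.update_of_ne hj, hw, Function.update_of_ne hj, Matrix.one_apply_eq]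
      · simp
    · rw [Finset.sum_eq_zero]
      · obtain ⟨j, hj⟩ := Function.ne_iff.1 hw
        have hji : j ≠ i := by
          rintro rfl
          simp at hj
        rw [Function.update_of_ne hji] at hj
        refine Finset.prod_eq_zero (Finset.mem_univ j) ?_
        rw [single, Function.update_of_ne hji, Matrix.one_apply_ne hj.symm]
      · intro p _
        rw [if_neg]
        intro h'
        exact hw (by conv_lhs => rw [h']
                     rw [h', Function.update_self])
  simp only [Matrix.mulVec, dotProduct, h, Finset.sum_mul]
  rw [Finset.sum_comm]
  refine Finset.sum_congr rfl fun p _ => ?_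
  simp only [ite_mul, zero_mul, Finset.sum_ite_eq', Finset.mem_univ, if_true]

/-- Acting on the factors one after the other amounts to the tensor product. -/
lemma slice_foldl_finRange {F : Fin n → QVec n → QVec n} {t : ZMod 2}
    {K : Fin n → Matrix (ZMod 2 × ZMod 2) (ZMod 2 × ZMod 2) ℂ}
    (hF : ∀ i v, slice t (F i v) = tensor (single i (K i)) *ᵥ slice t v) (v : QVec n) :
    slice t ((List.finRange n).foldl (fun v i => F i v) v) = tensor K *ᵥ slice t v := by
  have key : ∀ (l : List (Fin n)), l.Nodup → ∀ v : QVec n,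
      slice t (l.foldl (fun v i => F i v) v) =
        tensor (fun i => if i ∈ l then K i else 1) *ᵥ slice t v := by
    intro l
    induction l with
    | nil => intro _ v; simp [tensor_one]
    | cons i l ih =>
      intro hl v
      rw [List.nodup_cons] at hl
      rw [List.foldl_cons, ih hl.2, hF, Matrix.mulVec_mulVec, tensor_mul]
      congr 2
      funext j
      by_cases hj : j = i
      · subst hj
        simp [hl.1, single]
      · simp [single, hj]
  rw [key _ (List.nodup_finRange n)]
  simp

lemma slice_apply2_registers (A : Matrix (ZMod 2 × ZMod 2) (ZMod 2 × ZMod 2) ℂ) (i : Fin n)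
    (t : ZMod 2) (v : QVec n) :
    slice t (apply2 A (some (0, i)) (some (1, i)) v) = tensor (single i A) *ᵥ slice t v := by
  funext w
  rw [tensor_single_mulVec, Fintype.sum_prod_type]
  simp [slice, apply2, update_mem_zero, update_mem_one]

/-! ### Two copies of the input state -/

/-- The vector `φ ⊗ φ`, with the tensor factors grouped into pairs of qubits. -/
def pairVec (φ : NQubit n) : (Fin n → ZMod 2 × ZMod 2) → ℂ := fun w =>
  φ (fun i => (w i).1) * φ (fun i => (w i).2)

/-- The operator `W_y ⊗ W_y`, with the tensor factors grouped into pairs of qubits. -/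
def pairOp (y : Phase n) :
    Matrix (Fin n → ZMod 2 × ZMod 2) (Fin n → ZMod 2 × ZMod 2) ℂ :=
  tensor fun i => Matrix.kronecker (weyl1 (y.1 i) (y.2 i)) (weyl1 (y.1 i) (y.2 i))

lemma sum_pair {M : Type*} [AddCommMonoid M] (f : (Fin n → ZMod 2) → (Fin n → ZMod 2) → M) :
    ∑ w : Fin n → ZMod 2 × ZMod 2, f (fun i => (w i).1) (fun i => (w i).2) = ∑ u, ∑ v, f u v := by
  rw [← Fintype.sum_prod_type' f]
  exact (Equiv.arrowProdEquivProdArrow (Fin n) (fun _ => ZMod 2) (fun _ => ZMod 2)).sum_comp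
    fun y : Phase n => f y.1 y.2

lemma slice_zero_twoCopies (ψ : NQubit n) : slice 0 (twoCopies ψ) = pairVec ψ := by
  funext w
  simp [slice, twoCopies, pairVec]

lemma slice_one_twoCopies (ψ : NQubit n) : slice 1 (twoCopies ψ) = 0 := by
  funext w
  simp [slice, twoCopies]

lemma star_pairVec_dotProduct (φ χ : NQubit n) :
    star (pairVec φ) ⬝ᵥ pairVec χ = inner ℂ φ χ ^ 2 := by
  simp only [dotProduct, pairVec, Pi.star_apply]
  rw [sum_pair fun u v => star (φ u * φ v) * (χ u * χ v), PiLp.inner_apply, sq,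
    Finset.sum_mul_sum]
  refine Finset.sum_congr rfl fun u _ => Finset.sum_congr rfl fun v _ => ?_
  rw [RCLike.inner_apply, RCLike.inner_apply, star_mul']
  simp only [RCLike.star_def]
  ring

lemma pairOp_mulVec_pairVec (y : Phase n) (φ : NQubit n) :
    pairOp y *ᵥ pairVec φ = pairVec (weylMap y φ) := by
  funext w
  have h : ∀ u, weylMap y φ u = ∑ v, weyl y u v * φ v := fun u => rfl
  simp only [pairVec, h, Matrix.mulVec, dotProduct, Finset.sum_mul_sum]
  rw [← sum_pair fun u v => weyl y (fun i => (w i).1) u * φ u * (weyl y (fun i => (w i).2) v * φ v)]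
  refine Finset.sum_congr rfl fun w' _ => ?_
  simp only [pairOp, weyl_eq_tensor, tensor_apply, Matrix.kronecker, Matrix.kroneckerMap_apply,
    Finset.prod_mul_distrib]
  ring

lemma star_pairVec_dotProduct_pairOp (y : Phase n) (ψ : NQubit n) :
    star (pairVec ψ) ⬝ᵥ (pairOp y *ᵥ pairVec ψ) = ((weylExp ψ y ^ 2 : ℝ) : ℂ) := by
  rw [pairOp_mulVec_pairVec, star_pairVec_dotProduct, ← ofReal_weylExp]
  push_cast
  rfl

/-- The projectors of the Bell measurement of all `n` pairs, expanded in Weyl operators. -/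
lemma tensor_bellProj (x : Phase n) :
    tensor (fun i => bellProj (x.1 i) (x.2 i)) = ∑ y : Phase n,
      ((chi (symp x y) * (chi (∑ i, y.1 i * y.2 i) * (4 ^ n)⁻¹) : ℝ) : ℂ) • pairOp y := by
  ext u v
  rw [Matrix.sum_apply]
  have hb : ∀ i, bellProj (x.1 i) (x.2 i) (u i) (v i) = (1 / 4) * ∑ y : ZMod 2 × ZMod 2,
      (chi (x.1 i * y.2 + x.2 i * y.1) : ℂ) * ((chi (y.1 * y.2) : ℂ) *
      (weyl1 y.1 y.2 (u i).1 (v i).1 * weyl1 y.1 y.2 (u i).2 (v i).2)) := fun i =>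
    bellProj_apply _ _ _ _ _ _
  simp only [tensor_apply, hb, Finset.prod_mul_distrib]
  rw [← sum_phase_prod fun i y => (chi (x.1 i * y.2 + x.2 i * y.1) : ℂ) * ((chi (y.1 * y.2) : ℂ) *
      (weyl1 y.1 y.2 (u i).1 (v i).1 * weyl1 y.1 y.2 (u i).2 (v i).2)), Finset.mul_sum]
  refine Finset.sum_congr rfl fun y _ => ?_
  simp only [Matrix.smul_apply, smul_eq_mul, pairOp, tensor_apply, Matrix.kronecker,
    Matrix.kroneckerMap_apply, symp, chi_sum, Complex.ofReal_mul, Complex.ofReal_prod,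
    Finset.prod_mul_distrib, Finset.prod_const, Finset.card_univ, Fintype.card_fin]
  push_cast
  rw [one_div, inv_pow]
  ring

/-- The Bell measurement of all pairs of qubits of `ψ ⊗ ψ` has outcome `x` with probability
`bellDist ψ x`. -/
lemma normSq_bellMeasurement (ψ : NQubit n) (x : Fin n → ZMod 2 × ZMod 2) :
    normSq ((List.finRange n).foldl
      (fun v i => apply2 (bellProj (x i).1 (x i).2) (some (0, i)) (some (1, i)) v) (twoCopies ψ)) =
      bellDist ψ (fun i => (x i).1, fun i => (x i).2) := by
  have hs : ∀ t v, slice t ((List.finRange n).foldl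
      (fun v i => apply2 (bellProj (x i).1 (x i).2) (some (0, i)) (some (1, i)) v) v) =
      tensor (fun i => bellProj (x i).1 (x i).2) *ᵥ slice t v := fun t v =>
    slice_foldl_finRange
      (F := fun i v => apply2 (bellProj (x i).1 (x i).2) (some (0, i)) (some (1, i)) v)
      (fun i v => slice_apply2_registers _ i t v) v
  rw [normSq_eq, hs, hs, slice_one_twoCopies,
    slice_zero_twoCopies, Matrix.mulVec_zero, pairNormSq_zero, add_zero, ← Complex.ofReal_inj,
    ofReal_pairNormSq, Matrix.star_mulVec, ← Matrix.dotProduct_mulVec, Matrix.mulVec_mulVec,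
    tensor_conjTranspose, tensor_mul]
  simp only [bellProj_conjTranspose, bellProj_mul_self]
  rw [tensor_bellProj (fun i => (x i).1, fun i => (x i).2), Matrix.sum_mulVec, dotProduct_sum,
    bellDist, Complex.ofReal_sum]
  refine Finset.sum_congr rfl fun y _ => ?_
  rw [Matrix.smul_mulVec, dotProduct_smul, star_pairVec_dotProduct_pairOp, smul_eq_mul,
    ← Complex.ofReal_mul, Complex.ofReal_inj, charDist_eq]
  rw [← two_pow_mul_two_pow]
  field_simp

/-! ### The measurement of `W_x ⊗ W_x` with an ancilla -/

/-- The two controlled one-qubit Weyl gates at position `i`. -/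
def ctrlPair (x : Phase n) (i : Fin n) (v : QVec n) : QVec n :=
  apply2 (ctrlWeyl1 (x.1 i) (x.2 i)) none (some (1, i))
    (apply2 (ctrlWeyl1 (x.1 i) (x.2 i)) none (some (0, i)) v)

lemma slice_ctrlWeyl1 (t a b : ZMod 2) (r : Fin 2 × Fin n) (v : QVec n)
    (w : Fin n → ZMod 2 × ZMod 2) :
    slice t (apply2 (ctrlWeyl1 a b) none (some r) v) w =
      ∑ s, (if t = 0 then 1 else weyl1 a b) (mem t w (some r)) s *
        v (Function.update (mem t w) (some r) s) := by
  have h : Function.update (mem t w) none t = mem t w := Function.update_eq_self_iff.2 rfl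
  revert t
  rw [forall_zmod_two]
  constructor <;> intro h <;>
  simp [slice, apply2, sum_zmod_two (M := ℂ), ctrlWeyl1, projZ, h]

lemma slice_ctrlPair (x : Phase n) (i : Fin n) (t : ZMod 2) (v : QVec n) :
    slice t (ctrlPair x i v) = tensor (single i (if t = 0 then 1 else
      Matrix.kronecker (weyl1 (x.1 i) (x.2 i)) (weyl1 (x.1 i) (x.2 i)))) *ᵥ slice t v := by
  have hk : (if t = 0 then (1 : Matrix (ZMod 2 × ZMod 2) (ZMod 2 × ZMod 2) ℂ) else
      Matrix.kronecker (weyl1 (x.1 i) (x.2 i)) (weyl1 (x.1 i) (x.2 i))) =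
      Matrix.kronecker (if t = 0 then 1 else weyl1 (x.1 i) (x.2 i))
        (if t = 0 then 1 else weyl1 (x.1 i) (x.2 i)) := by
    split_ifs
    · exact Matrix.one_kronecker_one.symm
    · rfl
  funext w
  rw [hk, tensor_single_mulVec, Fintype.sum_prod_type, ctrlPair, slice_ctrlWeyl1,
    Finset.sum_comm]
  refine Finset.sum_congr rfl fun s _ => ?_
  rw [update_mem_one]
  rw [show apply2 (ctrlWeyl1 (x.1 i) (x.2 i)) none (some (0, i)) v
    (mem t (Function.update w i ((w i).1, s))) =
      slice t (apply2 (ctrlWeyl1 (x.1 i) (x.2 i)) none (some (0, i)) v)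
        (Function.update w i ((w i).1, s)) from rfl, slice_ctrlWeyl1, Finset.mul_sum]
  refine Finset.sum_congr rfl fun s' _ => ?_
  rw [update_mem_zero]
  simp only [mem_some_zero, mem_some_one, Function.update_self, Function.update_idem, slice,
    Matrix.kronecker, Matrix.kroneckerMap_apply]
  ring

/-- The memory after the Hadamard test circuit for `W_x ⊗ W_x` on two copies of `ψ`, before the
ancilla is measured. -/
def testVec (ψ : NQubit n) (x : Phase n) : QVec n :=
  apply1 hadamard none ((List.finRange n).foldl (fun v i => ctrlPair x i v)
    (apply1 hadamard none (twoCopies ψ)))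

lemma slice_testVec (ψ : NQubit n) (x : Phase n) (t : ZMod 2) :
    slice t (testVec ψ x) =
      (1 / 2 : ℂ) • (pairVec ψ + ((chi t : ℝ) : ℂ) • pairVec (weylMap x ψ)) := by
  have hslice : ∀ t, slice t (apply1 hadamard none (twoCopies ψ)) =
      ((Real.sqrt 2 : ℝ) : ℂ)⁻¹ • pairVec ψ := fun t => by
    rw [slice_apply1_none, slice_zero_twoCopies, slice_one_twoCopies, smul_zero, add_zero]
    simp [hadamard]
  have h0 := slice_foldl_finRange (F := fun i v => ctrlPair x i v) (t := 0)
    (fun i v => slice_ctrlPair x i 0 v) (apply1 hadamard none (twoCopies ψ))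
  have h1 := slice_foldl_finRange (F := fun i v => ctrlPair x i v) (t := 1)
    (fun i v => slice_ctrlPair x i 1 v) (apply1 hadamard none (twoCopies ψ))
  simp only [if_true, one_ne_zero, if_false] at h0 h1
  rw [tensor_one, Matrix.one_mulVec, hslice] at h0
  rw [hslice, Matrix.mulVec_smul] at h1
  rw [show (tensor fun i => Matrix.kronecker (weyl1 (x.1 i) (x.2 i)) (weyl1 (x.1 i) (x.2 i))) =
    pairOp x from rfl, pairOp_mulVec_pairVec] at h1
  rw [testVec, slice_apply1_none, h0, h1, smul_smul, smul_smul, ← inv_sqrt_two_mul_self,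
    smul_add, smul_smul]
  revert t
  rw [forall_zmod_two]
  constructor <;> simp [hadamard, div_eq_mul_inv]

/-- The ancilla of the Hadamard test reads `t` with probability `(1 + (-1)^t ⟨W_x⟩²) / 2`. -/
lemma normSq_testVec {ψ : NQubit n} (hψ : ‖ψ‖ = 1) (x : Phase n) (t : ZMod 2) :
    normSq (apply1 (projZ t) none (testVec ψ x)) = (1 + chi t * weylExp ψ x ^ 2) / 2 := by
  have hn : pairNormSq ((1 / 2 : ℂ) • (pairVec ψ + ((chi t : ℝ) : ℂ) • pairVec (weylMap x ψ))) =
      (1 + chi t * weylExp ψ x ^ 2) / 2 := by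
    rw [← Complex.ofReal_inj, ofReal_pairNormSq, star_smul, star_add, star_smul]
    simp only [smul_dotProduct, dotProduct_smul, add_dotProduct, dotProduct_add,
      star_pairVec_dotProduct]
    have h1 : inner ℂ (weylMap x ψ) ψ = (weylExp ψ x : ℂ) := by
      rw [weylMap_isSymmetric, ofReal_weylExp]
    have h2 : inner ℂ (weylMap x ψ) (weylMap x ψ) = (1 : ℂ) := by
      rw [inner_self_eq_norm_sq_to_K, norm_weylMap, hψ]; simp
    have h3 : inner ℂ ψ ψ = (1 : ℂ) := by
      rw [inner_self_eq_norm_sq_to_K, hψ]; simp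
    have h4 : ((chi t : ℝ) : ℂ) * ((chi t : ℝ) : ℂ) = 1 := by
      rw [← Complex.ofReal_mul, chi_mul_self, Complex.ofReal_one]
    rw [h1, h2, h3, ← ofReal_weylExp]
    simp only [smul_eq_mul, RCLike.star_def, map_div₀, map_one, Complex.conj_ofReal,
      Complex.conj_ofNat]
    push_cast
    linear_combination (1 / 4 : ℂ) * h4
  rw [normSq_eq, slice_apply1_none, slice_apply1_none, ← hn, ← slice_testVec]
  revert t
  rw [forall_zmod_two]
  constructor <;> simp [projZ, pairNormSq_zero]

/-! ### Expectations over the branches of a program -/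

lemma sum_map_flatMap {S T : Type*} (l : List S) (f : S → List T) (g : T → ℝ) :
    ((l.flatMap f).map g).sum = (l.map fun a => ((f a).map g).sum).sum := by
  induction l with
  | nil => simp
  | cons a l ih => simp [ih]

/-- The sum of `g` over the branches in which program `c` ends when started in branch `s`. If `g`
carries the factor `Branch.prob`, this is an expectation. -/
def branchSum (ψ : NQubit n) (c : Cmd) (g : Branch n → ℝ) (s : Branch n) : ℝ :=
  ((c.run ψ s).map g).sum

section BranchSum

variable (ψ : NQubit n) (g : Branch n → ℝ) (s : Branch n)

lemma branchSum_block_nil : branchSum ψ (Cmd.block []) g s = g s := by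
  simp [branchSum, Cmd.block, Cmd.run]

lemma branchSum_block_cons (c : Cmd) (cs : List Cmd) :
    branchSum ψ (Cmd.block (c :: cs)) g s = branchSum ψ c (branchSum ψ (Cmd.block cs) g) s :=
  sum_map_flatMap _ _ _

lemma branchSum_assign (v : Var) (e : Expr) :
    branchSum ψ (.assign v e) g s = g ((s.setReg v (e.eval s.reg)).tick (e.cost + 1)) := by
  simp [branchSum, Cmd.run]

lemma branchSum_load : branchSum ψ .load g s = g { s with
    vec := twoCopies ψ, weight := s.weight * normSq s.vec, copies := s.copies + 2,
    time := s.time + 2 * n } := by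
  simp [branchSum, Cmd.run]

lemma branchSum_hadamardAnc :
    branchSum ψ .hadamardAnc g s = g ((s.mapVec (apply1 hadamard none)).tick 1) := by
  simp [branchSum, Cmd.run]

lemma branchSum_measureAnc (v : Var) : branchSum ψ (.measureAnc v) g s =
    g (((s.mapVec (apply1 (projZ 0) none)).setReg v 1).tick 1) +
    g (((s.mapVec (apply1 (projZ 1) none)).setReg v (-1)).tick 1) := by
  simp [branchSum, Cmd.run]

end BranchSum

/-- Summation over the branches of a sweep with a choice from `O` at each position is summation
over all tuples of choices. -/
lemma sum_chainBranch_finRange {S O : Type} [Fintype O] {k : ℕ} {f : Fin k → S → List S}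
    {step : Fin k → O → S → S}
    (hf : ∀ j s (g : S → ℝ), ((f j s).map g).sum = ∑ o, g (step j o s)) (g : S → ℝ) (s : S) :
    ((chainBranch f (List.finRange k) s).map g).sum =
      ∑ x : Fin k → O, g ((List.finRange k).foldl (fun s j => step j (x j) s) s) := by
  have hmap : ∀ {J K : Type} (h : J → K) (f : K → S → List S) (l : List J) (s : S),
      chainBranch f (l.map h) s = chainBranch (fun j => f (h j)) l s := by
    intro J K h f l
    induction l with
    | nil => intro s; rfl
    | cons a l ih => intro s; simp only [List.map_cons, chainBranch, funext ih]
  induction k generalizing s with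
  | zero => simp [chainBranch]
  | succ k ih =>
    rw [List.finRange_succ]
    simp only [chainBranch, List.foldl_cons, List.foldl_map]
    rw [sum_map_flatMap, hf]
    simp only [hmap]
    rw [← (Fin.consEquiv fun _ => O).sum_comp, Fintype.sum_prod_type]
    refine Finset.sum_congr rfl fun o _ => ?_
    rw [ih (f := fun j => f j.succ) (step := fun j => step j.succ) fun j s g => hf j.succ s g]
    simp [Fin.consEquiv]

/-- A sweep without choices has a single branch. -/
lemma chainBranch_eq_singleton {S J : Type} {f : J → S → List S} {h : J → S → S}
    (hf : ∀ j s, f j s = [h j s]) (l : List J) (s : S) :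
    chainBranch f l s = [l.foldl (fun s j => h j s) s] := by
  induction l generalizing s with
  | nil => rfl
  | cons a l ih => simp [chainBranch, hf, ih]

lemma foldl_invariant {S J R : Type*} (π : S → R) {h : S → J → S}
    (hπ : ∀ s j, π (h s j) = π s) (l : List J) (s : S) : π (l.foldl h s) = π s := by
  induction l generalizing s with
  | nil => rfl
  | cons a l ih => rw [List.foldl_cons, ih, hπ]

/-- The effect at position `i` of a sweep of Bell measurements with outcome `o`. -/
def bellStep (A B : Arr) (i : Fin n) (o : ZMod 2 × ZMod 2) (s : Branch n) : Branch n :=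
  ((((s.mapVec (apply2 (bellProj o.1 o.2) (some (0, i)) (some (1, i)))).setBit A i o.1).setBit
    B i o.2).tick 1).tick 1

/-- The branch of a sweep of Bell measurements with outcomes `x`. -/
def bellBranch (A B : Arr) (x : Fin n → ZMod 2 × ZMod 2) (s : Branch n) : Branch n :=
  (List.finRange n).foldl (fun s i => bellStep A B i (x i) s) s

lemma branchSum_bell (ψ : NQubit n) (A B : Arr) (g : Branch n → ℝ) (s : Branch n) :
    branchSum ψ (.sweep [.bell A B]) g s = ∑ x, g (bellBranch A B x s) := by
  refine sum_chainBranch_finRange (step := bellStep A B) (fun i s g => ?_) g s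
  simp only [chainBranch, LocalInstr.run, Fintype.sum_prod_type, sum_zmod_two (M := ℝ)]
  simp [bellStep, add_assoc]

section BellBranch

variable (A B : Arr) (x : Fin n → ZMod 2 × ZMod 2) (s : Branch n)

@[simp] lemma bellBranch_reg : (bellBranch A B x s).reg = s.reg :=
  foldl_invariant Branch.reg (by intros; rfl) _ _

@[simp] lemma bellBranch_weight : (bellBranch A B x s).weight = s.weight :=
  foldl_invariant Branch.weight (by intros; rfl) _ _

lemma bellBranch_vec : (bellBranch A B x s).vec = (List.finRange n).foldl
    (fun v i => apply2 (bellProj (x i).1 (x i).2) (some (0, i)) (some (1, i)) v) s.vec :=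
  (List.foldl_hom Branch.vec fun _ _ => rfl).symm

lemma bellBranch_arr_of_ne {C : Arr} (hA : C ≠ A) (hB : C ≠ B) :
    (bellBranch A B x s).arr C = s.arr C :=
  foldl_invariant (fun s : Branch n => s.arr C)
    (fun s i => by simp [bellStep, Branch.tick, Branch.setBit, Branch.mapVec, hA, hB]) _ _

lemma bellBranch_arr_fst (hAB : A ≠ B) : (bellBranch A B x s).arr A = fun i => (x i).1 := by
  have key : ∀ (l : List (Fin n)) (s : Branch n) (i : Fin n),
      (l.foldl (fun s i => bellStep A B i (x i) s) s).arr A i =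
        if i ∈ l then (x i).1 else s.arr A i := by
    intro l
    induction l with
    | nil => simp
    | cons j l ih =>
      intro s i
      rw [List.foldl_cons, ih]
      by_cases hij : i = j
      · subst hij
        simp [bellStep, Branch.tick, Branch.setBit, Branch.mapVec, hAB]
      · simp [bellStep, Branch.tick, Branch.setBit, Branch.mapVec, hAB, hij]
  funext i
  rw [bellBranch, key, if_pos (List.mem_finRange i)]

lemma bellBranch_arr_snd : (bellBranch A B x s).arr B = fun i => (x i).2 := by
  have key : ∀ (l : List (Fin n)) (s : Branch n) (i : Fin n),
      (l.foldl (fun s i => bellStep A B i (x i) s) s).arr B i =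
        if i ∈ l then (x i).2 else s.arr B i := by
    intro l
    induction l with
    | nil => simp
    | cons j l ih =>
      intro s i
      rw [List.foldl_cons, ih]
      by_cases hij : i = j
      · subst hij
        simp [bellStep, Branch.tick, Branch.setBit, Branch.mapVec]
      · by_cases hAB : B = A <;>
        simp [bellStep, Branch.tick, Branch.setBit, Branch.mapVec, hij, hAB]
  funext i
  rw [bellBranch, key, if_pos (List.mem_finRange i)]

end BellBranch

/-- The effect at position `i` of the sweep that adds the two Bell samples. -/
def addStep (s : Branch n) (i : Fin n) : Branch n :=
  let t := (s.setBit .xa i (s.arr .xa i + s.arr .ya i)).tick 1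
  ((t.setBit .xb i (t.arr .xb i + t.arr .yb i)).tick 1).tick 1

/-- The branch of the sweep that adds the two Bell samples. -/
def addBranch (s : Branch n) : Branch n := (List.finRange n).foldl addStep s

lemma branchSum_addBit (ψ : NQubit n) (g : Branch n → ℝ) (s : Branch n) :
    branchSum ψ (.sweep [.addBit .xa .ya, .addBit .xb .yb]) g s = g (addBranch s) := by
  rw [branchSum, Cmd.run, chainBranch_eq_singleton (h := fun i s => addStep s i)]
  · simp [addBranch]
  · intro i s
    simp [chainBranch, LocalInstr.run, addStep]

section AddBranch

variable (s : Branch n)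

@[simp] lemma addBranch_reg : (addBranch s).reg = s.reg :=
  foldl_invariant Branch.reg (by intros; rfl) _ _

@[simp] lemma addBranch_weight : (addBranch s).weight = s.weight :=
  foldl_invariant Branch.weight (by intros; rfl) _ _

@[simp] lemma addBranch_vec : (addBranch s).vec = s.vec :=
  foldl_invariant Branch.vec (by intros; rfl) _ _

lemma addBranch_arr : (addBranch s).arr .xa = s.arr .xa + s.arr .ya ∧
    (addBranch s).arr .xb = s.arr .xb + s.arr .yb := by
  have key : ∀ l : List (Fin n), l.Nodup → ∀ (s : Branch n) (i : Fin n),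
      (l.foldl addStep s).arr .xa i =
        (if i ∈ l then s.arr .xa i + s.arr .ya i else s.arr .xa i) ∧
      (l.foldl addStep s).arr .xb i =
        (if i ∈ l then s.arr .xb i + s.arr .yb i else s.arr .xb i) := by
    intro l
    induction l with
    | nil => simp
    | cons j l ih =>
      intro hl s i
      rw [List.nodup_cons] at hl
      rw [List.foldl_cons, (ih hl.2 _ i).1, (ih hl.2 _ i).2]
      by_cases hij : i = j
      · subst hij
        simp [addStep, Branch.tick, Branch.setBit, hl.1]
      · simp [addStep, Branch.tick, Branch.setBit, hij]
  have h := key _ (List.nodup_finRange n) s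
  simp only [List.mem_finRange, if_true] at h
  exact ⟨funext fun i => (h i).1, funext fun i => (h i).2⟩

end AddBranch

/-- The effect at position `i` of the sweep of controlled Weyl gates. -/
def ctrlStep (s : Branch n) (i : Fin n) : Branch n :=
  (((s.mapVec (ctrlPair (s.arr .xa, s.arr .xb) i)).tick 1).tick 1).tick 1

/-- The branch of the sweep of controlled Weyl gates. -/
def ctrlBranch (s : Branch n) : Branch n := (List.finRange n).foldl ctrlStep s

lemma branchSum_ctrlWeyl (ψ : NQubit n) (g : Branch n → ℝ) (s : Branch n) :
    branchSum ψ (.sweep [.ctrlWeyl 0 .xa .xb, .ctrlWeyl 1 .xa .xb]) g s = g (ctrlBranch s) := by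
  rw [branchSum, Cmd.run, chainBranch_eq_singleton (h := fun i s => ctrlStep s i)]
  · simp [ctrlBranch]
  · intro i s
    rfl

section CtrlBranch

variable (s : Branch n)

@[simp] lemma ctrlBranch_reg : (ctrlBranch s).reg = s.reg :=
  foldl_invariant Branch.reg (by intros; rfl) _ _

@[simp] lemma ctrlBranch_weight : (ctrlBranch s).weight = s.weight :=
  foldl_invariant Branch.weight (by intros; rfl) _ _

lemma ctrlBranch_vec : (ctrlBranch s).vec = (List.finRange n).foldl
    (fun v i => ctrlPair (s.arr .xa, s.arr .xb) i v) s.vec := by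
  have key : ∀ (l : List (Fin n)) (s : Branch n), (l.foldl ctrlStep s).vec =
      l.foldl (fun v i => ctrlPair (s.arr .xa, s.arr .xb) i v) s.vec := by
    intro l
    induction l with
    | nil => intro s; rfl
    | cons j l ih => intro s; rw [List.foldl_cons, ih]; rfl
  exact key _ s

end CtrlBranch

/-! ### One round of the tester -/

/-- Bell difference sampling leaves a sample of `q_ψ` in the arrays `xa`, `xb`. -/
lemma branchSum_bellDifferenceSampling (ψ : NQubit n) (k : (Var → ℝ) → Phase n → ℝ)
    (s : Branch n) :
    branchSum ψ bellDifferenceSampling (fun t => t.prob * k t.reg (t.arr .xa, t.arr .xb)) s =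
      s.prob * ∑ z, weylDist ψ z * k s.reg z := by
  have hpair : ∀ f : Phase n → ℝ, ∑ x : Fin n → ZMod 2 × ZMod 2,
      f (fun i => (x i).1, fun i => (x i).2) = ∑ y, f y := fun f =>
    (Equiv.arrowProdEquivProdArrow (Fin n) (fun _ => ZMod 2) (fun _ => ZMod 2)).sum_comp f
  have h : branchSum ψ bellDifferenceSampling
      (fun t => t.prob * k t.reg (t.arr .xa, t.arr .xb)) s =
      ∑ x : Phase n, ∑ y : Phase n, s.prob * bellDist ψ x * bellDist ψ y * k s.reg (x + y) := by
    rw [← hpair]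
    simp only [← hpair fun y => s.prob * bellDist ψ _ * bellDist ψ y * k s.reg (_ + y)]
    simp only [bellDifferenceSampling, branchSum_block_cons, branchSum_load, branchSum_bell,
      branchSum_addBit, branchSum_block_nil]
    refine Finset.sum_congr rfl fun x _ => Finset.sum_congr rfl fun y _ => ?_
    simp only [Branch.prob, addBranch_reg, addBranch_weight, addBranch_vec, (addBranch_arr _).1,
      (addBranch_arr _).2, bellBranch_reg, bellBranch_weight, bellBranch_vec,
      normSq_bellMeasurement]
    rw [bellBranch_arr_fst .ya .yb y _ (by decide), bellBranch_arr_snd .ya .yb,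
      bellBranch_arr_of_ne .ya .yb y _ (C := .xa) (by decide) (by decide),
      bellBranch_arr_of_ne .ya .yb y _ (C := .xb) (by decide) (by decide),
      bellBranch_arr_fst .xa .xb x _ (by decide), bellBranch_arr_snd .xa .xb]
    rfl
  rw [h, Finset.mul_sum]
  have hxx : ∀ x : Phase n, x + x = 0 := fun x => by
    simp only [Prod.ext_iff, funext_iff, Prod.fst_add, Prod.snd_add, Pi.add_apply,
      CharTwo.add_self_eq_zero]
    exact ⟨fun _ => rfl, fun _ => rfl⟩
  calc ∑ x : Phase n, ∑ y : Phase n, s.prob * bellDist ψ x * bellDist ψ y * k s.reg (x + y)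
      = ∑ x : Phase n, ∑ z : Phase n, s.prob * bellDist ψ x * bellDist ψ (x + z) * k s.reg z := by
        refine Finset.sum_congr rfl fun x _ => ?_
        rw [← Equiv.sum_comp (Equiv.addLeft x)]
        refine Finset.sum_congr rfl fun z _ => ?_
        simp only [Equiv.coe_addLeft, ← add_assoc, hxx, zero_add]
    _ = _ := by
        rw [Finset.sum_comm]
        refine Finset.sum_congr rfl fun z _ => ?_
        rw [← sum_bellDist_mul_bellDist, Finset.sum_mul, Finset.mul_sum]
        exact Finset.sum_congr rfl fun x _ => by ring

/-- The Weyl measurement reports `±1` with mean `⟨W_x⟩²`. -/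
lemma branchSum_weylMeasurement {ψ : NQubit n} (hψ : ‖ψ‖ = 1) (h : (Var → ℝ) → ℝ)
    (s : Branch n) :
    branchSum ψ weylMeasurement (fun t => t.prob * h t.reg) s = s.prob *
      ((1 + weylExp ψ (s.arr .xa, s.arr .xb) ^ 2) / 2 * h (Function.update s.reg .outcome 1) +
      (1 - weylExp ψ (s.arr .xa, s.arr .xb) ^ 2) / 2 *
        h (Function.update s.reg .outcome (-1))) := by
  simp only [weylMeasurement, branchSum_block_cons, branchSum_load, branchSum_hadamardAnc,
    branchSum_ctrlWeyl, branchSum_measureAnc, branchSum_block_nil]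
  have h0 := normSq_testVec hψ (s.arr .xa, s.arr .xb) 0
  have h1 := normSq_testVec hψ (s.arr .xa, s.arr .xb) 1
  simp only [chi_zero, chi_one, testVec, one_mul, neg_mul, ← sub_eq_add_neg] at h0 h1
  simp only [Branch.prob, Branch.tick, Branch.setReg, Branch.mapVec, ctrlBranch_reg,
    ctrlBranch_weight, ctrlBranch_vec, h0, h1]
  ring

/-- The body of the tester's loop. -/
def testerBody : Cmd := Cmd.block [
  bellDifferenceSampling,
  weylMeasurement,
  .assign .sum (.add (.var .sum) (.var .outcome)),
  .assign .count (.add (.var .count) (.num 1))]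

/-- The registers after one round with outcome `o`. -/
def recordOutcome (r : Var → ℝ) (o : ℝ) : Var → ℝ :=
  Function.update (Function.update (Function.update r .outcome o) .sum (r .sum + o)) .count
    (r .count + 1)

/-- One round records the outcome `±1` with mean `η`. -/
lemma branchSum_testerBody {ψ : NQubit n} (hψ : ‖ψ‖ = 1) (h : (Var → ℝ) → ℝ) (s : Branch n) :
    branchSum ψ testerBody (fun t => t.prob * h t.reg) s = s.prob *
      ((1 + eta ψ) / 2 * h (recordOutcome s.reg 1) +
        (1 - eta ψ) / 2 * h (recordOutcome s.reg (-1))) := by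
  have hlast : branchSum ψ (Cmd.block [.assign .sum (.add (.var .sum) (.var .outcome)),
      .assign .count (.add (.var .count) (.num 1))]) (fun t => t.prob * h t.reg) =
      fun t : Branch n => t.prob * h (Function.update (Function.update t.reg .sum
        (t.reg .sum + t.reg .outcome)) .count (t.reg .count + 1)) := by
    funext t
    simp [branchSum_block_cons, branchSum_block_nil, branchSum_assign, Branch.tick,
      Branch.setReg, Branch.prob, Expr.eval]
  rw [testerBody, branchSum_block_cons]
  let k : (Var → ℝ) → Phase n → ℝ := fun r x =>
    (1 + weylExp ψ x ^ 2) / 2 * h (recordOutcome r 1) +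
      (1 - weylExp ψ x ^ 2) / 2 * h (recordOutcome r (-1))
  have hmid : branchSum ψ (Cmd.block [weylMeasurement,
      .assign .sum (.add (.var .sum) (.var .outcome)),
      .assign .count (.add (.var .count) (.num 1))]) (fun t => t.prob * h t.reg) =
      fun t : Branch n => t.prob * k t.reg (t.arr .xa, t.arr .xb) := by
    funext t
    rw [branchSum_block_cons, hlast, branchSum_weylMeasurement hψ fun r =>
      h (Function.update (Function.update r .sum (r .sum + r .outcome)) .count (r .count + 1))]
    simp [recordOutcome, k]
  rw [hmid, branchSum_bellDifferenceSampling ψ k]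
  congr 1
  have hs := sum_weylDist hψ
  have he : eta ψ = ∑ z, weylDist ψ z * weylExp ψ z ^ 2 := by
    simp only [eta, two_pow_mul_charDist]
  have hsplit : ∀ z, weylDist ψ z * ((1 + weylExp ψ z ^ 2) / 2 * h (recordOutcome s.reg 1) +
      (1 - weylExp ψ z ^ 2) / 2 * h (recordOutcome s.reg (-1))) =
      weylDist ψ z * ((h (recordOutcome s.reg 1) + h (recordOutcome s.reg (-1))) / 2) +
      weylDist ψ z * weylExp ψ z ^ 2 *
        ((h (recordOutcome s.reg 1) - h (recordOutcome s.reg (-1))) / 2) := fun z => by ring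
  simp only [k, hsplit]
  rw [Finset.sum_add_distrib, ← Finset.sum_mul, ← Finset.sum_mul, hs, ← he]
  ring

/-! ### Resources and registers along a branch -/

/-- In every branch, program `c` consumes `a` copies, takes `b` steps, keeps weights nonnegative
and changes no register outside `W`. -/
def Frame (ψ : NQubit n) (c : Cmd) (a b : ℕ) (W : Set Var) : Prop :=
  ∀ s, ∀ t ∈ c.run ψ s, t.copies = s.copies + a ∧ t.time = s.time + b ∧
    (0 ≤ s.weight → 0 ≤ t.weight) ∧ ∀ v ∉ W, t.reg v = s.reg v

section Frame

variable {ψ : NQubit n} {W : Set Var}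

lemma Frame.block_nil : Frame ψ (Cmd.block []) 0 0 W := fun s t ht => by
  rw [show Cmd.run ψ (Cmd.block []) s = [s] from rfl, List.mem_singleton] at ht
  subst ht
  simp

lemma Frame.block_cons {c : Cmd} {cs : List Cmd} {a b a' b' : ℕ} (hc : Frame ψ c a b W)
    (hcs : Frame ψ (Cmd.block cs) a' b' W) :
    Frame ψ (Cmd.block (c :: cs)) (a + a') (b + b') W := fun s t ht => by
  rw [show Cmd.run ψ (Cmd.block (c :: cs)) s = (c.run ψ s).flatMap ((Cmd.block cs).run ψ) from rfl,
    List.mem_flatMap] at ht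
  obtain ⟨u, hu, ht⟩ := ht
  obtain ⟨h1, h2, h3, h4⟩ := hc s u hu
  obtain ⟨k1, k2, k3, k4⟩ := hcs u t ht
  exact ⟨by omega, by omega, fun h => k3 (h3 h), fun v hv => (k4 v hv).trans (h4 v hv)⟩

lemma Frame.congr {c : Cmd} {a b a' b' : ℕ} (h : Frame ψ c a b W) (ha : a = a') (hb : b = b') :
    Frame ψ c a' b' W := ha ▸ hb ▸ h

lemma Frame.load : Frame ψ .load 2 (2 * n) W := fun s t ht => by
  rw [Cmd.run, List.mem_singleton] at ht
  subst ht
  exact ⟨rfl, rfl, fun h => mul_nonneg h (normSq_nonneg _), fun _ _ => rfl⟩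

lemma Frame.hadamardAnc : Frame ψ .hadamardAnc 0 1 W := fun s t ht => by
  rw [Cmd.run, List.mem_singleton] at ht
  subst ht
  exact ⟨rfl, rfl, id, fun _ _ => rfl⟩

lemma Frame.measureAnc {v : Var} (hv : v ∈ W) : Frame ψ (.measureAnc v) 0 1 W := fun s t ht => by
  rw [Cmd.run, List.mem_pair] at ht
  rcases ht with rfl | rfl <;>
  exact ⟨rfl, rfl, id, fun w hw => Function.update_of_ne (ne_of_mem_of_not_mem hv hw).symm _ _⟩

lemma Frame.assign {v : Var} (hv : v ∈ W) (e : Expr) :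
    Frame ψ (.assign v e) 0 (e.cost + 1) W := fun s t ht => by
  rw [Cmd.run, List.mem_singleton] at ht
  subst ht
  exact ⟨rfl, rfl, id, fun w hw => Function.update_of_ne (ne_of_mem_of_not_mem hv hw).symm _ _⟩

/-- If each step of a chain takes `b` ticks and touches only the quantum memory and the arrays,
so does the chain. -/
lemma mem_chainBranch {J : Type} {f : J → Branch n → List (Branch n)} {b : ℕ}
    (hf : ∀ j s, ∀ t ∈ f j s, t.copies = s.copies ∧ t.time = s.time + b ∧ t.weight = s.weight ∧
      t.reg = s.reg) (l : List J) :
    ∀ s, ∀ t ∈ chainBranch f l s, t.copies = s.copies ∧ t.time = s.time + l.length * b ∧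
      t.weight = s.weight ∧ t.reg = s.reg := by
  induction l with
  | nil =>
    intro s t ht
    rw [chainBranch, List.mem_singleton] at ht
    subst ht
    simp
  | cons j l ih =>
    intro s t ht
    rw [chainBranch, List.mem_flatMap] at ht
    obtain ⟨u, hu, ht⟩ := ht
    obtain ⟨h1, h2, h3, h4⟩ := hf j s u hu
    obtain ⟨k1, k2, k3, k4⟩ := ih u t ht
    refine ⟨k1.trans h1, ?_, k3.trans h3, k4.trans h4⟩
    rw [k2, h2, List.length_cons]
    ring

lemma mem_localInstr_run (i : Fin n) (ins : LocalInstr) (s : Branch n) :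
    ∀ t ∈ ins.run i s, t.copies = s.copies ∧ t.time = s.time + 1 ∧ t.weight = s.weight ∧
      t.reg = s.reg := by
  intro t ht
  cases ins with
  | bell A B =>
    rw [LocalInstr.run, List.mem_map] at ht
    obtain ⟨o, -, rfl⟩ := ht
    exact ⟨rfl, rfl, rfl, rfl⟩
  | addBit A B =>
    rw [LocalInstr.run, List.mem_singleton] at ht
    subst ht
    exact ⟨rfl, rfl, rfl, rfl⟩
  | ctrlWeyl c A B =>
    rw [LocalInstr.run, List.mem_singleton] at ht
    subst ht
    exact ⟨rfl, rfl, rfl, rfl⟩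

lemma Frame.sweep (body : List LocalInstr) :
    Frame ψ (.sweep body) 0 (n * (body.length + 1)) W := fun s t ht => by
  obtain ⟨h1, h2, h3, h4⟩ := mem_chainBranch (b := body.length + 1) (fun i s t ht => by
    rw [List.mem_map] at ht
    obtain ⟨u, hu, rfl⟩ := ht
    obtain ⟨k1, k2, k3, k4⟩ := mem_chainBranch (mem_localInstr_run i) body s u hu
    refine ⟨k1, ?_, k3, k4⟩
    change u.time + 1 = _
    rw [k2]
    ring) (List.finRange n) s t ht
  rw [List.length_finRange] at h2
  exact ⟨h1, h2, fun h => h3 ▸ h, fun v _ => by rw [h4]⟩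

lemma Frame.bellDifferenceSampling : Frame ψ bellDifferenceSampling 4 (11 * n) W := by
  refine (block_cons .load <| block_cons (.sweep _) <| block_cons .load <|
    block_cons (.sweep _) <| block_cons (.sweep _) block_nil).congr rfl ?_
  simp only [List.length_cons, List.length_nil]
  ring

lemma Frame.weylMeasurement (hW : Var.outcome ∈ W) :
    Frame ψ weylMeasurement 2 (5 * n + 3) W := by
  refine (block_cons .load <| block_cons .hadamardAnc <| block_cons (.sweep _) <|
    block_cons .hadamardAnc <| block_cons (.measureAnc hW) block_nil).congr rfl ?_
  simp only [List.length_cons, List.length_nil]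
  ring

end Frame

/-- One round uses six copies and `16 n + 11` steps, and increments the counter. -/
lemma mem_testerBody_run {ψ : NQubit n} {s t : Branch n} (ht : t ∈ testerBody.run ψ s) :
    t.copies = s.copies + 6 ∧ t.time = s.time + (16 * n + 11) ∧ (0 ≤ s.weight → 0 ≤ t.weight) ∧
      t.reg .alpha1 = s.reg .alpha1 ∧ t.reg .gamma = s.reg .gamma ∧
      t.reg .count = s.reg .count + 1 := by
  have h1 : Frame ψ (Cmd.block [bellDifferenceSampling, weylMeasurement,
      .assign .sum (.add (.var .sum) (.var .outcome))]) 6 (16 * n + 7) {.outcome, .sum} :=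
    (Frame.block_cons .bellDifferenceSampling <| .block_cons (.weylMeasurement (by simp)) <|
      .block_cons (.assign (by simp) _) .block_nil).congr rfl (by simp only [Expr.cost]; ring)
  have hassoc : testerBody.run ψ s = ((Cmd.block [bellDifferenceSampling, weylMeasurement,
      .assign .sum (.add (.var .sum) (.var .outcome))]).run ψ s).flatMap
      ((Cmd.assign .count (.add (.var .count) (.num 1))).run ψ) := by
    simp [testerBody, Cmd.block, Cmd.run, List.flatMap_assoc]
  rw [hassoc, List.mem_flatMap] at ht
  obtain ⟨u, hu, ht⟩ := ht
  obtain ⟨k1, k2, k3, k4⟩ := h1 s u hu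
  rw [Cmd.run, List.mem_singleton] at ht
  subst ht
  refine ⟨k1, ?_, k3, ?_, ?_, ?_⟩
  · change u.time + (1 + 1 + 1 + 1) = _
    rw [k2]
    ring
  · simpa [Branch.tick, Branch.setReg] using k4 .alpha1 (by simp)
  · simpa [Branch.tick, Branch.setReg] using k4 .gamma (by simp)
  · simpa [Branch.tick, Branch.setReg, Expr.eval] using k4 .count (by simp)

/-- The branches after `k` rounds. -/
def rounds (ψ : NQubit n) : ℕ → Branch n → List (Branch n) :=
  iterBranch fun t => (testerBody.run ψ t).map (Branch.tick 1)

lemma mem_rounds {ψ : NQubit n} (k : ℕ) : ∀ {s t : Branch n}, t ∈ rounds ψ k s →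
    t.copies = s.copies + 6 * k ∧ t.time = s.time + k * (16 * n + 12) ∧
      (0 ≤ s.weight → 0 ≤ t.weight) ∧
      t.reg .alpha1 = s.reg .alpha1 ∧ t.reg .gamma = s.reg .gamma ∧
      t.reg .count = s.reg .count + k := by
  induction k with
  | zero =>
    intro s t ht
    rw [rounds, iterBranch, List.mem_singleton] at ht
    subst ht
    simp
  | succ k ih =>
    intro s t ht
    rw [rounds, iterBranch, List.mem_flatMap] at ht
    obtain ⟨u, hu, ht⟩ := ht
    rw [List.mem_map] at hu
    obtain ⟨r, hr, rfl⟩ := hu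
    obtain ⟨h1, h2, h3, h4, h5, h6⟩ := mem_testerBody_run hr
    obtain ⟨k1, k2, k3, k4, k5, k6⟩ := ih ht
    simp only [Branch.tick] at k1 k2 k3 k4 k5 k6
    refine ⟨by omega, ?_, fun h => k3 (h3 h), k4.trans h4, k5.trans h5, ?_⟩
    · rw [k2, h2]; ring
    · rw [k6, h6]; push_cast; ring

/-! ### Concentration of the estimate -/

/-- Hoeffding's lemma for a sign with mean `η`. -/
lemma two_point_mgf_le {η : ℝ} (h0 : -1 ≤ η) (h1 : η ≤ 1) (l : ℝ) :
    (1 + η) / 2 * Real.exp (l * (1 - η)) + (1 - η) / 2 * Real.exp (l * (-1 - η)) ≤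
      Real.exp (l ^ 2 / 2) := by
  let p : ENNReal := ENNReal.ofReal ((1 + η) / 2)
  let q : ENNReal := ENNReal.ofReal ((1 - η) / 2)
  let μ : MeasureTheory.Measure ℝ := p • MeasureTheory.Measure.dirac 1 +
    q • MeasureTheory.Measure.dirac (-1)
  have hp : p.toReal = (1 + η) / 2 := ENNReal.toReal_ofReal (by linarith)
  have hq : q.toReal = (1 - η) / 2 := ENNReal.toReal_ofReal (by linarith)
  have hμ : MeasureTheory.IsProbabilityMeasure μ := ⟨by
    simp only [μ, MeasureTheory.Measure.add_apply, MeasureTheory.Measure.smul_apply,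
      MeasureTheory.measure_univ, smul_eq_mul, mul_one, p, q]
    rw [← ENNReal.ofReal_add (by linarith) (by linarith),
      show (1 + η) / 2 + (1 - η) / 2 = 1 by ring, ENNReal.ofReal_one]⟩
  have hint : ∀ f : ℝ → ℝ, ∫ x, f x ∂μ = (1 + η) / 2 * f 1 + (1 - η) / 2 * f (-1) := fun f => by
    have hi : ∀ (r : ENNReal) (_ : r ≠ ⊤) (a : ℝ),
        MeasureTheory.Integrable f (r • MeasureTheory.Measure.dirac a) := fun r hr a =>
      (MeasureTheory.integrable_dirac (by simp)).smul_measure hr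
    rw [MeasureTheory.integral_add_measure (hi _ ENNReal.ofReal_ne_top _)
      (hi _ ENNReal.ofReal_ne_top _), MeasureTheory.integral_smul_measure,
      MeasureTheory.integral_smul_measure, MeasureTheory.integral_dirac,
      MeasureTheory.integral_dirac, hp, hq, smul_eq_mul, smul_eq_mul]
  have hae : ∀ᵐ x ∂μ, x - η ∈ Set.Icc (-1 - η) (1 - η) := by
    rw [MeasureTheory.ae_add_measure_iff]
    constructor
    · refine MeasureTheory.Measure.ae_smul_measure ?_ _
      rw [MeasureTheory.ae_dirac_eq]
      exact ⟨by linarith, by linarith⟩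
    · refine MeasureTheory.Measure.ae_smul_measure ?_ _
      rw [MeasureTheory.ae_dirac_eq]
      exact ⟨by linarith, by linarith⟩
  have hmean : ∫ x, (x - η) ∂μ = 0 := by rw [hint]; ring
  have h := (ProbabilityTheory.hasSubgaussianMGF_of_mem_Icc_of_integral_eq_zero
    (X := fun x : ℝ => x - η) (by fun_prop) hae hmean).mgf_le l
  rw [ProbabilityTheory.mgf, hint] at h
  refine h.trans (le_of_eq ?_)
  have h2 : (1 - η) - (-1 - η) = 2 := by ring
  rw [h2]
  norm_num

/-- The exponential moments of `∑ X_i - k η` after `k` rounds factorise over the rounds. -/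
lemma sum_rounds_exp {ψ : NQubit n} (hψ : ‖ψ‖ = 1) (l : ℝ) (k : ℕ) (s : Branch n) :
    ((rounds ψ k s).map fun t =>
      t.prob * Real.exp (l * (t.reg .sum - eta ψ * t.reg .count))).sum =
    ((1 + eta ψ) / 2 * Real.exp (l * (1 - eta ψ)) +
      (1 - eta ψ) / 2 * Real.exp (l * (-1 - eta ψ))) ^ k *
      (s.prob * Real.exp (l * (s.reg .sum - eta ψ * s.reg .count))) := by
  induction k generalizing s with
  | zero => simp [rounds, iterBranch]
  | succ k ih =>
    rw [rounds, iterBranch, sum_map_flatMap, List.map_map]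
    have h := branchSum_testerBody hψ (fun r => Real.exp (l * (r .sum - eta ψ * r .count))) s
    have hrec : ∀ o, Real.exp (l * (recordOutcome s.reg o .sum -
        eta ψ * recordOutcome s.reg o .count)) =
        Real.exp (l * (s.reg .sum - eta ψ * s.reg .count)) * Real.exp (l * (o - eta ψ)) :=
      fun o => by
        rw [← Real.exp_add]
        congr 1
        simp only [recordOutcome, Function.update_self, ne_eq, reduceCtorEq, not_false_eq_true,
          Function.update_of_ne]
        ring
    rw [hrec, hrec, branchSum] at h
    have hstep : ∀ t : Branch n, ((rounds ψ k (Branch.tick 1 t)).map fun t =>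
        t.prob * Real.exp (l * (t.reg .sum - eta ψ * t.reg .count))).sum =
        ((1 + eta ψ) / 2 * Real.exp (l * (1 - eta ψ)) +
          (1 - eta ψ) / 2 * Real.exp (l * (-1 - eta ψ))) ^ k *
          (t.prob * Real.exp (l * (t.reg .sum - eta ψ * t.reg .count))) := fun t => ih _
    simp only [Function.comp_def]
    refine (congrArg List.sum (List.map_congr_left fun t _ => hstep t)).trans ?_
    rw [List.sum_map_mul_left, h, pow_succ]
    ring

/-- Chernoff bound: up to the probability `2 exp (-k g² / 2)`, the average of the outcomes of `k`
rounds is within `g` of `η`. -/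
lemma one_sub_le_sum_rounds {ψ : NQubit n} (hψ : ‖ψ‖ = 1) {k : ℕ} (hk : 0 < k) {g : ℝ} (hg : 0 ≤ g)
    {s : Branch n} (hs : s.prob = 1) (hw : 0 ≤ s.weight) (hsum : s.reg .sum = 0)
    (hcount : s.reg .count = 0) {f : Branch n → ℝ} (hf0 : ∀ t ∈ rounds ψ k s, 0 ≤ f t)
    (hf : ∀ t ∈ rounds ψ k s, |t.reg .sum / t.reg .count - eta ψ| < g → t.prob ≤ f t) :
    1 - 2 * Real.exp (-(k * g ^ 2 / 2)) ≤ ((rounds ψ k s).map f).sum := by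
  have hkpos : (0 : ℝ) < k := by exact_mod_cast hk
  -- The exponential moment at `0` is the total probability.
  have htotal : ((rounds ψ k s).map Branch.prob).sum = 1 := by
    have h := sum_rounds_exp hψ 0 k s
    simp only [zero_mul, Real.exp_zero, mul_one, hs] at h
    rw [show (1 + eta ψ) / 2 + (1 - eta ψ) / 2 = 1 by ring, one_pow] at h
    exact h
  -- The exponents `l = g` and `l = -g` are optimal for the two tails.
  have htail : ∀ l : ℝ, l ^ 2 = g ^ 2 → ((rounds ψ k s).map fun t =>
      t.prob * Real.exp (l * (t.reg .sum - eta ψ * t.reg .count))).sum ≤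
      Real.exp (k * g ^ 2 / 2) := fun l hl => by
    rw [sum_rounds_exp hψ, hs, hsum, hcount]
    have h1 := two_point_mgf_le (by linarith [eta_nonneg ψ]) (eta_le_one hψ) l
    have h2 := eta_nonneg ψ
    have h3 := eta_le_one hψ
    have h4 : 0 ≤ (1 + eta ψ) / 2 * Real.exp (l * (1 - eta ψ)) +
        (1 - eta ψ) / 2 * Real.exp (l * (-1 - eta ψ)) := by
      have : 0 ≤ (1 + eta ψ) / 2 := by linarith
      have : 0 ≤ (1 - eta ψ) / 2 := by linarith
      positivity
    calc _ ≤ Real.exp (l ^ 2 / 2) ^ k * (1 * Real.exp (l * (0 - eta ψ * 0))) := by gcongr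
      _ = Real.exp (k * g ^ 2 / 2) := by
        rw [← Real.exp_nat_mul, hl]; simp [mul_div_assoc]
  have hpoint : ∀ t ∈ rounds ψ k s, t.prob ≤ f t + (Real.exp (-(k * g ^ 2)) *
      (t.prob * Real.exp (g * (t.reg .sum - eta ψ * t.reg .count))) +
      Real.exp (-(k * g ^ 2)) *
      (t.prob * Real.exp (-g * (t.reg .sum - eta ψ * t.reg .count)))) := fun t ht => by
    obtain ⟨-, -, hwt, -, -, hct⟩ := mem_rounds k ht
    rw [hcount, zero_add] at hct
    have hp : 0 ≤ t.prob := mul_nonneg (hwt hw) (normSq_nonneg _)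
    by_cases hgood : |t.reg .sum / t.reg .count - eta ψ| < g
    · have := hf t ht hgood
      have : 0 ≤ Real.exp (-(k * g ^ 2)) *
        (t.prob * Real.exp (g * (t.reg .sum - eta ψ * t.reg .count))) := by positivity
      have : 0 ≤ Real.exp (-(k * g ^ 2)) *
        (t.prob * Real.exp (-g * (t.reg .sum - eta ψ * t.reg .count))) := by positivity
      linarith
    · have := hf0 t ht
      -- In a bad branch one of the two exponential weights is at least one.
      have hbad : ∀ l : ℝ, k * g ^ 2 ≤ l * (t.reg .sum - eta ψ * t.reg .count) →
          t.prob ≤ Real.exp (-(k * g ^ 2)) *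
            (t.prob * Real.exp (l * (t.reg .sum - eta ψ * t.reg .count))) := fun l hl => by
        rw [mul_left_comm, ← Real.exp_add]
        exact le_mul_of_one_le_right hp (Real.one_le_exp (by linarith))
      have hpos : ∀ l : ℝ, 0 ≤ Real.exp (-(k * g ^ 2)) *
        (t.prob * Real.exp (l * (t.reg .sum - eta ψ * t.reg .count))) := fun l => by positivity
      have hdev : t.reg .sum / t.reg .count - eta ψ =
          (t.reg .sum - eta ψ * t.reg .count) / k := by
        rw [hct]; field_simp
      rw [not_lt, hdev, le_abs, le_div_iff₀ hkpos, ← neg_div, le_div_iff₀ hkpos] at hgood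
      rcases hgood with h | h
      · have := hbad g (by nlinarith)
        linarith [hpos (-g)]
      · have := hbad (-g) (by nlinarith)
        linarith [hpos g]
  have hsumle := List.sum_le_sum hpoint
  rw [List.sum_map_add, List.sum_map_add, List.sum_map_mul_left, List.sum_map_mul_left] at hsumle
  have e1 := htail g rfl
  have e2 := htail (-g) (by ring)
  have hexp : Real.exp (-(k * g ^ 2)) * Real.exp (k * g ^ 2 / 2) =
      Real.exp (-(k * g ^ 2 / 2)) := by
    rw [← Real.exp_add]; congr 1; ring
  have e3 := mul_le_mul_of_nonneg_left e1 (Real.exp_pos (-(k * g ^ 2))).le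
  have e4 := mul_le_mul_of_nonneg_left e2 (Real.exp_pos (-(k * g ^ 2))).le
  rw [hexp] at e3 e4
  have htotal' : ((rounds ψ k s).map fun t => t.prob).sum = 1 := htotal
  linarith

/-! ### The whole run -/

/-- The branch in which the tester enters its loop. -/
def loopStart (n : ℕ) (α₁ α₂ δ : ℝ) : Branch n :=
  let γ := α₁ ^ 6 - (3 * α₂ + 1) / 4
  ((((((((initBranch n α₁ α₂ δ).setReg .gamma γ).tick 16).setReg .m
    (8 * Real.log (2 / δ) / γ ^ 2)).tick 11).setReg .sum 0).tick 2).setReg .count 0).tick 2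

/-- What the tester does to a branch after its loop. -/
def finish (t : Branch n) : Branch n :=
  let u := ((t.tick 2).setReg .etaHat (t.reg .sum / t.reg .count)).tick 4
  open Classical in
  (u.setReg .out (if t.reg .sum / t.reg .count > t.reg .alpha1 ^ 6 - t.reg .gamma / 2
    then 1 else 0)).tick 13

lemma testerRuns_eq (ψ : NQubit n) (α₁ α₂ δ : ℝ) : testerRuns ψ α₁ α₂ δ =
    (rounds ψ ⌈8 * Real.log (2 / δ) / (α₁ ^ 6 - (3 * α₂ + 1) / 4) ^ 2⌉₊
      (loopStart n α₁ α₂ δ)).map finish := by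
  have hblock : ∀ c cs (s : Branch n), Cmd.run ψ (Cmd.block (c :: cs)) s =
      (c.run ψ s).flatMap ((Cmd.block cs).run ψ) := fun _ _ _ => rfl
  have hassign : ∀ v e (s : Branch n), Cmd.run ψ (.assign v e) s =
      [(s.setReg v (e.eval s.reg)).tick (e.cost + 1)] := fun _ _ _ => rfl
  have hrep : ∀ e (s : Branch n), Cmd.run ψ (.rep e testerBody) s =
      (rounds ψ ⌈e.eval s.reg⌉₊ s).map (Branch.tick (e.cost + 1)) := fun _ _ => rfl
  rw [testerRuns, tolerantTester]
  change Cmd.run ψ (Cmd.block [_, _, _, _, .rep _ testerBody, _, _]) _ = _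
  simp only [hblock, hassign, List.flatMap_cons, List.flatMap_nil, List.append_nil, hrep,
    List.flatMap_map]
  rw [← List.flatMap_singleton' (List.map finish _), List.flatMap_map]
  congr 1
  simp [loopStart, Expr.eval, Expr.cost, Branch.tick, Branch.setReg, initBranch]

lemma mem_testerRuns {ψ : NQubit n} {α₁ α₂ δ : ℝ} {s : Branch n}
    (hs : s ∈ testerRuns ψ α₁ α₂ δ) :
    s.copies = 6 * ⌈8 * Real.log (2 / δ) / (α₁ ^ 6 - (3 * α₂ + 1) / 4) ^ 2⌉₊ ∧
    s.time = ⌈8 * Real.log (2 / δ) / (α₁ ^ 6 - (3 * α₂ + 1) / 4) ^ 2⌉₊ * (16 * n + 12) + 50 := by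
  rw [testerRuns_eq, List.mem_map] at hs
  obtain ⟨t, ht, rfl⟩ := hs
  obtain ⟨h1, h2, -⟩ := mem_rounds _ ht
  constructor
  · simpa [finish, Branch.tick, Branch.setReg, loopStart, initBranch] using h1
  · simp only [finish, Branch.tick, Branch.setReg, loopStart, initBranch] at h2 ⊢
    omega

lemma prob_finish (t : Branch n) : (finish t).prob = t.prob := rfl

lemma normSq_initBranch (α₁ α₂ δ : ℝ) : normSq (initBranch n α₁ α₂ δ).vec = 1 := by
  simp [normSq, initBranch, apply_ite]

/-- If an event contains all runs whose estimate is within `γ / 2` of `η`, the tester realises it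
with probability at least `1 - δ`: the number of rounds makes the Chernoff bound at most `δ`. -/
lemma one_sub_le_testerProb {ψ : NQubit n} (hψ : ‖ψ‖ = 1) {α₁ α₂ δ γ : ℝ} (hδ : 0 < δ)
    (hδ1 : δ < 1) (hγ : γ = α₁ ^ 6 - (3 * α₂ + 1) / 4) (hpos : 0 < γ) {E : Branch n → Prop}
    (hE : ∀ s : Branch n, |s.reg .etaHat - eta ψ| < γ / 2 →
      s.reg .out = (open Classical in if s.reg .etaHat > α₁ ^ 6 - γ / 2 then 1 else 0) → E s) :
    1 - δ ≤ testerProb ψ α₁ α₂ δ E := by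
  classical
  set m : ℝ := 8 * Real.log (2 / δ) / γ ^ 2 with hm
  have hlog : 0 < Real.log (2 / δ) := Real.log_pos (by rw [lt_div_iff₀ hδ]; linarith)
  have hmpos : 0 < m := by positivity
  have hk : 0 < ⌈m⌉₊ := Nat.ceil_pos.2 hmpos
  rw [testerProb, testerRuns_eq, ← hγ, ← hm, List.map_map]
  have hvec : normSq (loopStart n α₁ α₂ δ).vec = 1 := normSq_initBranch α₁ α₂ δ
  have hw : (loopStart n α₁ α₂ δ).weight = 1 := rfl
  have hbound := one_sub_le_sum_rounds hψ hk (g := γ / 2) (by positivity)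
    (s := loopStart n α₁ α₂ δ) (by rw [Branch.prob, hvec, hw, one_mul]) (by rw [hw]; norm_num)
    (by simp [loopStart, Branch.tick, Branch.setReg])
    (by simp [loopStart, Branch.tick, Branch.setReg])
    (f := (fun s => if E s then s.prob else 0) ∘ finish)
    (fun t ht => by
      obtain ⟨-, -, hwt, -⟩ := mem_rounds _ ht
      have : 0 ≤ t.prob := mul_nonneg (hwt (by rw [hw]; norm_num)) (normSq_nonneg _)
      simp only [Function.comp_apply, prob_finish]
      split_ifs <;> simp [this])
    (fun t ht hgood => by
      obtain ⟨-, -, -, h1, h2, -⟩ := mem_rounds _ ht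
      have h1' : t.reg .alpha1 = α₁ := by
        rw [h1]; simp [loopStart, Branch.tick, Branch.setReg, initBranch]
      have h2' : t.reg .gamma = γ := by
        rw [h2, hγ]; simp [loopStart, Branch.tick, Branch.setReg]
      have hEt : E (finish t) := by
        refine hE _ ?_ ?_
        · simpa [finish, Branch.tick, Branch.setReg] using hgood
        · simp [finish, Branch.tick, Branch.setReg, h1', h2']
      simp only [Function.comp_apply, hEt, if_true, prob_finish, le_refl])
  refine le_trans ?_ hbound
  have hexp : Real.exp (-(⌈m⌉₊ * (γ / 2) ^ 2 / 2)) ≤ δ / 2 := by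
    have h1 : Real.log (2 / δ) ≤ ⌈m⌉₊ * (γ / 2) ^ 2 / 2 := by
      have h2 : m * γ ^ 2 = 8 * Real.log (2 / δ) := by rw [hm]; field_simp
      have h3 : m * γ ^ 2 ≤ ⌈m⌉₊ * γ ^ 2 := by
        gcongr
        exact Nat.le_ceil m
      nlinarith
    calc Real.exp (-(⌈m⌉₊ * (γ / 2) ^ 2 / 2)) ≤ Real.exp (-Real.log (2 / δ)) :=
          Real.exp_le_exp.2 (neg_le_neg h1)
      _ = δ / 2 := by rw [Real.exp_neg, Real.exp_log (by positivity), inv_div]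
  linarith

/-- The number of steps against the sample complexity. Since `γ ≤ 1` and `log (2/δ) ≥ 1/2`, the
additive constants and the rounding are absorbed by the factor. -/
lemma steps_le {n : ℕ} (hn : 1 ≤ n) {x : ℝ} (hx : 1 / 2 ≤ x) :
    ((⌈8 * x⌉₊ * (16 * n + 12) + 50 : ℕ) : ℝ) ≤ 380 * (n * x) := by
  have hn' : (1 : ℝ) ≤ n := by exact_mod_cast hn
  have h1 : (⌈8 * x⌉₊ : ℝ) ≤ 10 * x := (Nat.ceil_lt_add_one (by linarith)).le.trans (by linarith)
  push_cast
  calc (⌈8 * x⌉₊ : ℝ) * (16 * n + 12) + 50 ≤ 10 * x * (28 * n) + 100 * x * n := by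
        have h2 : (16 : ℝ) * n + 12 ≤ 28 * n := by linarith
        have h3 : (50 : ℝ) ≤ 100 * x * n := by nlinarith
        gcongr
    _ = 380 * (n * x) := by ring

end

end StabTest

theorem mainTheorem3 :
    ∃ C : ℝ, ∀ (n : ℕ) (α₁ α₂ δ γ : ℝ) (ψ : StabTest.NQubit n),
      1 ≤ n → α₁ ∈ Set.Icc (0 : ℝ) 1 → α₂ ∈ Set.Icc (0 : ℝ) 1 → 0 < δ → δ < 1 →
      γ = α₁ ^ 6 - (3 * α₂ + 1) / 4 → 0 < γ → ‖ψ‖ = 1 →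
      -- the estimate of `η`
      1 - δ ≤ StabTest.testerProb ψ α₁ α₂ δ (fun s => |s.reg .etaHat - StabTest.eta ψ| < γ / 2) ∧
      -- the decision
      (α₁ ≤ StabTest.stabFidelity ψ →
        1 - δ ≤ StabTest.testerProb ψ α₁ α₂ δ (fun s => s.reg .out = 1)) ∧
      (StabTest.stabFidelity ψ ≤ α₂ →
        1 - δ ≤ StabTest.testerProb ψ α₁ α₂ δ (fun s => s.reg .out = 0)) ∧
      -- copies and time, in every branch of the computation
      (∀ s ∈ StabTest.testerRuns ψ α₁ α₂ δ,
        s.copies = 6 * ⌈8 * Real.log (2 / δ) / γ ^ 2⌉₊ ∧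
        (s.time : ℝ) ≤ C * (n * Real.log (2 / δ) / γ ^ 2) ∧
        (δ ≤ 1 / 2 → (s.time : ℝ) ≤ C * (n * Real.log (1 / δ) / γ ^ 2))) := by
  refine ⟨760, fun n α₁ α₂ δ γ ψ hn hα₁ hα₂ hδ hδ1 hγ hpos hψ => ⟨?_, fun hF => ?_, fun hF => ?_,
    fun s hs => ?_⟩⟩
  · exact StabTest.one_sub_le_testerProb hψ hδ hδ1 hγ hpos fun s h _ => h
  · have heta : α₁ ^ 6 ≤ StabTest.eta ψ :=
      (pow_le_pow_left₀ hα₁.1 hF 6).trans (StabTest.stabFidelity_pow_six_le_eta ψ)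
    refine StabTest.one_sub_le_testerProb hψ hδ hδ1 hγ hpos fun s h hout => ?_
    rw [hout, if_pos]
    linarith [(abs_lt.1 h).1]
  · have heta : StabTest.eta ψ ≤ α₁ ^ 6 - γ := by
      have := StabTest.eta_le_stabFidelity hψ
      linarith
    refine StabTest.one_sub_le_testerProb hψ hδ hδ1 hγ hpos fun s h hout => ?_
    rw [hout, if_neg]
    linarith [(abs_lt.1 h).2]
  · obtain ⟨hcopies, htime⟩ := StabTest.mem_testerRuns hs
    rw [← hγ] at hcopies htime
    have hγ1 : γ ≤ 1 := by
      have := pow_le_one₀ hα₁.1 hα₁.2 (n := 6)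
      linarith [hα₂.1]
    have hlog2 : Real.log 2 ≤ Real.log (2 / δ) :=
      Real.log_le_log (by norm_num) (by rw [le_div_iff₀ hδ]; linarith)
    have hlog : 1 / 2 ≤ Real.log (2 / δ) := by linarith [Real.log_two_gt_d9]
    have hx : 1 / 2 ≤ Real.log (2 / δ) / γ ^ 2 := by
      refine hlog.trans (le_div_self (by linarith) (by positivity) ?_)
      exact pow_le_one₀ hpos.le hγ1
    have hsteps := StabTest.steps_le hn hx
    rw [← mul_div_assoc, ← htime, ← mul_div_assoc] at hsteps
    refine ⟨hcopies, hsteps.trans ?_, fun hδ2 => hsteps.trans ?_⟩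
    · have : 0 ≤ n * Real.log (2 / δ) / γ ^ 2 := by positivity
      linarith
    · -- For `δ ≤ 1/2` one has `2/δ ≤ (1/δ)²`, which costs a factor two.
      have hlogle : Real.log (2 / δ) ≤ 2 * Real.log (1 / δ) := by
        rw [Real.log_div (by norm_num) hδ.ne', Real.log_div (by norm_num) hδ.ne', Real.log_one]
        have := Real.log_le_log hδ hδ2
        rw [one_div, Real.log_inv] at this
        linarith
      calc 380 * (n * Real.log (2 / δ) / γ ^ 2) ≤ 380 * (n * (2 * Real.log (1 / δ)) / γ ^ 2) := by
            gcongr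
        _ = 760 * (n * Real.log (1 / δ) / γ ^ 2) := by ring
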